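/- Let $\mathsf{C}(G)$ denote the number of connected components of a finite simple graph $G$, and call two graphs on the same vertex set edge-neighboring if there is an edge $e$ with $E_1\setminus\{e\}=E_2\setminus\{e\}$. For every $c>0$ there is a constant $C=C(c)>0$ such that for every integer $K>0$ and all $\varepsilon>0$, $\kappa>0$ there is a randomized algorithm $\mathcal{A}'$ in the adjacency-list query model (degree queries: given $v$, return $\deg(v)$; neighbor queries: given $v$ and $i$, return the $i$-th neighbor of $v$, or $\perp$ if $i>\deg(v)$; the order of the neighbors is arbitrary) with the following properties, where $\log$ is the natural logarithm. 1. (Privacy) $\mathcal{A}'$ is $\varepsilon$-edge differentially private: for all edge-neighboring graphs $G_1,G_2$ and all measurable $S\subseteq\mathbb{R}$, $\Pr[\mathcal{A}'(G_1)\in S]\le e^{\varepsilon}\Pr[\mathcal{A}'(G_2)\in S]$ (for any adjacency-list representations of $G_1$ and $G_2$). 2. (Accuracy) For every graph $G$ on $n\ge 2$ vertices, with probability at least $1-\frac{1}{n^{c}}-\frac{1}{n^{c-1}(e^{\varepsilon}-1)/K+1}$, $$\left|\mathcal{A}'(G)-\mathsf{C}(G)\right|\le \kappa n\left(\frac{8c}{\varepsilon}+\frac{1}{\log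 n}\right)+\frac{2c\log n}{\varepsilon}+\frac{1}{Kn}.$$ 3. (Queries) On every graph with $n\ge 2$ vertices, $\mathcal{A}'$ always makes at most $C\cdot\frac{\log^3 n}{\kappa^2}\cdot\max\left\{0,\log\frac{\log n}{\kappa}\right\}$ queries. -/

import Mathlib

open MeasureTheory

/-- Two graphs on the same vertex set are edge-neighboring if they agree up to one edge `e`. -/
def EdgeNeighboring {V : Type*} (G₁ G₂ : SimpleGraph V) : Prop :=
  ∃ e : Sym2 V, G₁.edgeSet \ {e} = G₂.edgeSet \ {e}

/-- An adjacency-list representation of `G`: for every vertex, its neighbors, each listed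
exactly once, in an arbitrary order. -/
structure AdjList {n : ℕ} (G : SimpleGraph (Fin n)) where
  nbrs : Fin n → List (Fin n)
  nodup : ∀ v, (nbrs v).Nodup
  mem_iff : ∀ v w, w ∈ nbrs v ↔ G.Adj v w

/-- Deterministic adaptive algorithms (decision trees) in the adjacency-list query model on the
vertex set `Fin n`, with real output. `degree v next` asks for the degree of `v`;
`neighbor v i next` asks for the neighbor of `v` at position `i` (counted from `0`) of its
adjacency list. The computation continues with `next` applied to the answer. -/
inductive QueryTree (n : ℕ) : Type where
  | output (x : ℝ) : QueryTree n
  | degree (v : Fin n) (next : ℕ → QueryTree n) : QueryTree n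
  | neighbor (v : Fin n) (i : Fin n) (next : Option (Fin n) → QueryTree n) : QueryTree n

namespace QueryTree

/-- The output on the input `L`. A neighbor query past the end of a list is answered `none`. -/
def run {n : ℕ} {G : SimpleGraph (Fin n)} (L : AdjList G) : QueryTree n → ℝ
  | output x => x
  | degree v next => run L (next (L.nbrs v).length)
  | neighbor v i next => run L (next (L.nbrs v)[(i : ℕ)]?)

/-- The number of queries made on the input `L`. -/
def queries {n : ℕ} {G : SimpleGraph (Fin n)} (L : AdjList G) : QueryTree n → ℕ
  | output _ => 0
  | degree v next => queries L (next (L.nbrs v).length) + 1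
  | neighbor v i next => queries L (next (L.nbrs v)[(i : ℕ)]?) + 1

end QueryTree

/-- A randomized algorithm in the adjacency-list query model on `n`-vertex graphs: random coins
`ω` from a probability space, and a decision tree that is executed for each outcome `ω`. -/
structure RandQueryAlg (n : ℕ) where
  Coins : Type
  mCoins : MeasurableSpace Coins
  P : Measure Coins
  isProb : IsProbabilityMeasure P
  tree : Coins → QueryTree n
  measurable_run : ∀ (G : SimpleGraph (Fin n)) (L : AdjList G),
    Measurable fun ω => (tree ω).run L

namespace RandQueryAlg

/-- The distribution of the output on the input `L`. -/
noncomputable def law {n : ℕ} (A : RandQueryAlg n) {G : SimpleGraph (Fin n)} (L : AdjList G) :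
    Measure ℝ :=
  @Measure.map _ _ A.mCoins _ (fun ω => (A.tree ω).run L) A.P

/-- `ε`-edge differential privacy: for edge-neighboring graphs, in whatever adjacency-list
representations they are given, the output distributions are within a factor `exp ε`. -/
def IsEdgeDP {n : ℕ} (A : RandQueryAlg n) (ε : ℝ) : Prop :=
  ∀ (G₁ G₂ : SimpleGraph (Fin n)), EdgeNeighboring G₁ G₂ →
    ∀ (L₁ : AdjList G₁) (L₂ : AdjList G₂) (S : Set ℝ), MeasurableSet S →
      A.law L₁ S ≤ ENNReal.ofReal (Real.exp ε) * A.law L₂ S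

end RandQueryAlg

/-- The number of connected components of a graph. -/
noncomputable def numComponents {V : Type*} (G : SimpleGraph V) : ℕ :=
  Nat.card G.ConnectedComponent

/-- The additive error `κ n (8c/ε + 1/log n) + 2 c log n / ε + 1/(K n)`. -/
noncomputable def ccError (K : ℕ) (c ε κ : ℝ) (n : ℕ) : ℝ :=
  κ * n * (8 * c / ε + 1 / Real.log n) + 2 * c * Real.log n / ε + 1 / ((K : ℝ) * n)

/-! The number of components is the sum over all vertices `v` of `1 / compSize G v`. This sum is
split dyadically: `bucketInv j` keeps the vertices whose component has size in `[2^j, 2^(j+1))`.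
Deciding this and finding the size takes at most `4^(j+1)` queries from `v`, and dropping the
components of size at least `2^J` loses at most `n / 2^J`. Level `j` receives `m * 4^(J-1-j)`
uniform samples, so every level costs `m * 4^J` queries, while single samples and the total second
moment stay bounded independently of the level (`sampleValue_le`, `sum_sampleValue_sq_le`). A
Bernstein bound (`card_tail_le`) then controls the sampling error.

For privacy, Laplace noise is added. An extra edge changes only the sizes in the merged component,
and the reciprocals there sum to at most 2 before and to 1 after, so all levels together change by
at most 3 (`sum_abs_sub_le`). One unlucky sample may change by much more than the average, but the
output density is an average over the random samples. Exchanging the summands one at a time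
(`sum_shift_le`, `sum_pi_shift_le`) shows that only the average change enters, up to a factor `exp
(2 * B / b)`, where `B` bounds one summand and `b` is the noise scale.

With `x = log n / κ`, sampling is used for `2 ≤ x ≤ n`. For `x < 2` the constant `n / 2` is accurate
enough; for `x > n` the whole graph can be read. In all cases the failure probability is at most
`n^(-c)`. -/

/-! ### Edge-neighboring graphs and reachability -/

section AddEdge

variable {V : Type*}

/-- `G'` arises from `G` by adding the edge `uw` (or equals `G` and contains the edge). -/
structure AddsEdge (G G' : SimpleGraph V) (u w : V) : Prop where
  le : G ≤ G'
  adj : G'.Adj u w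
  or_eq : ∀ a b, G'.Adj a b → G.Adj a b ∨ s(a, b) = s(u, w)

theorem EdgeNeighboring.cases {G₁ G₂ : SimpleGraph V} (h : EdgeNeighboring G₁ G₂) :
    G₁ = G₂ ∨ (∃ u w, AddsEdge G₁ G₂ u w) ∨ ∃ u w, AddsEdge G₂ G₁ u w := by
  obtain ⟨e, he⟩ := h
  have key : ∀ a b, s(a, b) ≠ e → (G₁.Adj a b ↔ G₂.Adj a b) := by
    intro a b hab
    have := Set.ext_iff.1 he s(a, b)
    simpa [hab] using this
  induction e using Sym2.ind with
  | _ u w =>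
    have hsymm : ∀ (G : SimpleGraph V) a b, s(a, b) = s(u, w) → (G.Adj a b ↔ G.Adj u w) := by
      intro G a b hab
      rw [← SimpleGraph.mem_edgeSet, hab, SimpleGraph.mem_edgeSet]
    by_cases h₁ : G₁.Adj u w <;> by_cases h₂ : G₂.Adj u w
    · left
      ext a b
      by_cases hab : s(a, b) = s(u, w)
      · rw [hsymm _ _ _ hab, hsymm _ _ _ hab]; tauto
      · exact key a b hab
    · right; right
      refine ⟨u, w, ⟨fun a b hab => ?_, h₁, fun a b hab => ?_⟩⟩
      · by_cases hs : s(a, b) = s(u, w)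
        · exact absurd ((hsymm _ _ _ hs).1 hab) h₂
        · exact (key a b hs).2 hab
      · by_cases hs : s(a, b) = s(u, w)
        · exact Or.inr hs
        · exact Or.inl ((key a b hs).1 hab)
    · right; left
      refine ⟨u, w, ⟨fun a b hab => ?_, h₂, fun a b hab => ?_⟩⟩
      · by_cases hs : s(a, b) = s(u, w)
        · exact absurd ((hsymm _ _ _ hs).1 hab) h₁
        · exact (key a b hs).1 hab
      · by_cases hs : s(a, b) = s(u, w)
        · exact Or.inr hs
        · exact Or.inl ((key a b hs).2 hab)
    · left
      ext a b
      by_cases hab : s(a, b) = s(u, w)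
      · rw [hsymm _ _ _ hab, hsymm _ _ _ hab]; tauto
      · exact key a b hab

namespace AddsEdge

variable {G G' : SimpleGraph V} {u w : V}

/-- Along a walk from `u`, each use of the new edge lands on `u` or `w`, where the walk in `G`
restarts. -/
theorem reachable_or (h : AddsEdge G G' u w) {v : V} (hv : G'.Reachable u v) :
    G.Reachable u v ∨ G.Reachable w v := by
  rw [SimpleGraph.reachable_iff_reflTransGen] at hv
  induction hv with
  | refl => exact Or.inl (SimpleGraph.Reachable.refl u)
  | @tail b c _ hbc ih =>
    rcases h.or_eq b c hbc with hG | hs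
    · exact ih.imp (fun r => r.trans hG.reachable) (fun r => r.trans hG.reachable)
    · rcases Sym2.eq_iff.1 hs with ⟨_, rfl⟩ | ⟨_, rfl⟩
      · exact Or.inr (SimpleGraph.Reachable.refl _)
      · exact Or.inl (SimpleGraph.Reachable.refl _)

theorem reachable_of_not (h : AddsEdge G G' u w) {v x : V} (hv : ¬ G'.Reachable u v)
    (hx : G'.Reachable v x) : G.Reachable v x := by
  rw [SimpleGraph.reachable_iff_reflTransGen] at hx
  induction hx with
  | refl => exact SimpleGraph.Reachable.refl v
  | @tail b c _ hbc ih =>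
    rcases h.or_eq b c hbc with hG | hs
    · exact ih.trans hG.reachable
    · have hvb : G'.Reachable b v := (ih.mono h.le).symm
      rcases Sym2.eq_iff.1 hs with ⟨rfl, _⟩ | ⟨rfl, _⟩
      · exact absurd hvb hv
      · exact absurd (h.adj.reachable.trans hvb) hv

end AddsEdge

end AddEdge

/-! ### Component sizes and their sensitivity to one edge -/

section Components

variable {V : Type*} [Fintype V]

open Classical in
/-- The vertex set of the connected component of `v`. -/
noncomputable def compFinset (G : SimpleGraph V) (v : V) : Finset V :=
  Finset.univ.filter (G.Reachable v)

/-- The number of vertices of the connected component of `v`. -/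
noncomputable def compSize (G : SimpleGraph V) (v : V) : ℕ := (compFinset G v).card

theorem mem_compFinset {G : SimpleGraph V} {v w : V} :
    w ∈ compFinset G v ↔ G.Reachable v w := by
  simp [compFinset]

theorem compSize_pos (G : SimpleGraph V) (v : V) : 0 < compSize G v :=
  Finset.card_pos.2 ⟨v, mem_compFinset.2 (SimpleGraph.Reachable.refl v)⟩

theorem compFinset_eq_of_reachable {G : SimpleGraph V} {v w : V} (h : G.Reachable v w) :
    compFinset G w = compFinset G v := by
  ext x
  simp only [mem_compFinset]
  exact ⟨fun hx => h.trans hx, fun hx => h.symm.trans hx⟩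

theorem sum_compFinset_inv_compSize (G : SimpleGraph V) (v : V) :
    ∑ w ∈ compFinset G v, (1 / (compSize G w : ℝ)) = 1 := by
  have h : ∀ w ∈ compFinset G v, (1 / (compSize G w : ℝ)) = 1 / (compSize G v : ℝ) := by
    intro w hw
    rw [compSize, compFinset_eq_of_reachable (mem_compFinset.1 hw), compSize]
  rw [Finset.sum_congr rfl h, Finset.sum_const, nsmul_eq_mul]
  have := compSize_pos G v
  change (compSize G v : ℝ) * _ = 1
  field_simp

/-- The reciprocals add up to 1 on each component. -/
theorem numComponents_eq_sum (G : SimpleGraph V) :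
    (numComponents G : ℝ) = ∑ v, 1 / (compSize G v : ℝ) := by
  classical
  rw [← Finset.sum_fiberwise (s := Finset.univ) (g := G.connectedComponentMk)]
  have : ∀ c : G.ConnectedComponent,
      ∑ v with G.connectedComponentMk v = c, (1 / (compSize G v : ℝ)) = 1 := by
    intro c
    obtain ⟨v, rfl⟩ := c.exists_rep
    refine Eq.trans (Finset.sum_congr ?_ fun _ _ => rfl) (sum_compFinset_inv_compSize G v)
    ext w
    simp only [Finset.mem_filter, Finset.mem_univ, true_and, mem_compFinset]
    exact (SimpleGraph.ConnectedComponent.eq).trans ⟨fun h => h.symm, fun h => h.symm⟩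
  rw [Finset.sum_congr rfl fun c _ => this c]
  simp [numComponents, Nat.card_eq_fintype_card]

theorem numComponents_le_card (G : SimpleGraph V) :
    (numComponents G : ℝ) ≤ Fintype.card V := by
  rw [numComponents_eq_sum]
  refine (Finset.sum_le_card_nsmul _ _ 1 fun v _ => ?_).trans (by simp)
  have : (1 : ℝ) ≤ compSize G v := by exact_mod_cast compSize_pos G v
  rw [div_le_one (by linarith)]
  exact this

namespace AddsEdge

variable {G G' : SimpleGraph V} {u w : V}

theorem compSize_eq (h : AddsEdge G G' u w) {v : V} (hv : v ∉ compFinset G' u) :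
    compSize G v = compSize G' v := by
  rw [mem_compFinset] at hv
  unfold compSize
  congr 1
  ext x
  simp only [mem_compFinset]
  exact ⟨fun hx => hx.mono h.le, h.reachable_of_not hv⟩

theorem compSize_le (h : AddsEdge G G' u w) (v : V) : compSize G v ≤ compSize G' v := by
  refine Finset.card_le_card fun x hx => ?_
  rw [mem_compFinset] at hx ⊢
  exact hx.mono h.le

/-- The merged component is covered by the old components of `u` and `w`, each contributing 1. These
may coincide, hence only an inequality. -/
theorem sum_inv_compSize_le_two (h : AddsEdge G G' u w) :
    ∑ v ∈ compFinset G' u, (1 / (compSize G v : ℝ)) ≤ 2 := by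
  classical
  have hsub : compFinset G' u ⊆ compFinset G u ∪ compFinset G w := by
    intro v hv
    rw [Finset.mem_union, mem_compFinset, mem_compFinset]
    exact h.reachable_or (mem_compFinset.1 hv)
  have hpos : ∀ v, 0 ≤ 1 / (compSize G v : ℝ) := fun v => by positivity
  calc ∑ v ∈ compFinset G' u, (1 / (compSize G v : ℝ))
      ≤ ∑ v ∈ compFinset G u ∪ compFinset G w, (1 / (compSize G v : ℝ)) :=
        Finset.sum_le_sum_of_subset_of_nonneg hsub fun v _ _ => hpos v
    _ ≤ ∑ v ∈ compFinset G u ∪ compFinset G w, (1 / (compSize G v : ℝ))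
        + ∑ v ∈ compFinset G u ∩ compFinset G w, (1 / (compSize G v : ℝ)) :=
        le_add_of_nonneg_right (Finset.sum_nonneg fun v _ => hpos v)
    _ = 2 := by
        rw [Finset.sum_union_inter, sum_compFinset_inv_compSize, sum_compFinset_inv_compSize]
        norm_num

theorem abs_numComponents_sub_le (h : AddsEdge G G' u w) :
    |(numComponents G : ℝ) - numComponents G'| ≤ 1 := by
  classical
  have hsplit : (numComponents G : ℝ) - numComponents G' =
      ∑ v ∈ compFinset G' u, (1 / (compSize G v : ℝ)) - 1 := by
    refine Eq.trans ?_ (congrArg (_ - ·) (sum_compFinset_inv_compSize G' u))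
    rw [numComponents_eq_sum, numComponents_eq_sum, ← Finset.sum_sub_distrib, ← Finset.sum_sub_distrib]
    refine (Finset.sum_subset (Finset.subset_univ _) fun v _ hv => ?_).symm
    rw [h.compSize_eq hv, sub_self]
  have hlow : (1 : ℝ) ≤ ∑ v ∈ compFinset G' u, (1 / (compSize G v : ℝ)) := by
    refine (sum_compFinset_inv_compSize G' u).symm.le.trans (Finset.sum_le_sum fun v _ => ?_)
    refine one_div_le_one_div_of_le (by exact_mod_cast compSize_pos G v) ?_
    exact_mod_cast h.compSize_le v
  rw [hsplit, abs_le]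
  constructor <;> linarith [h.sum_inv_compSize_le_two]

/-- A nonnegative decomposition of (a part of) `m ↦ 1 / m` changes by at most `3` in total when
an edge is added. -/
theorem sum_abs_sub_le (h : AddsEdge G G' u w) {ι : Type*} (s : Finset ι) (φ : ι → ℕ → ℝ)
    (hφ : ∀ j m, 0 ≤ φ j m) (hsum : ∀ m, ∑ j ∈ s, φ j m ≤ 1 / (m : ℝ)) :
    ∑ j ∈ s, ∑ v, |φ j (compSize G v) - φ j (compSize G' v)| ≤ 3 := by
  classical
  rw [Finset.sum_comm]
  -- For nonnegative reals `|s - t| ≤ s + t`; the merged component then gives at most 2 from `G` and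
  -- 1 from `G'`.
  have hv : ∀ v, ∑ j ∈ s, |φ j (compSize G v) - φ j (compSize G' v)|
      ≤ 1 / (compSize G v : ℝ) + 1 / (compSize G' v : ℝ) := by
    intro v
    refine le_trans (Finset.sum_le_sum fun j _ => ?_)
      ((Finset.sum_add_distrib (s := s)).trans_le (add_le_add (hsum _) (hsum _)))
    rw [abs_le]
    constructor <;> linarith [hφ j (compSize G v), hφ j (compSize G' v)]
  calc ∑ v, ∑ j ∈ s, |φ j (compSize G v) - φ j (compSize G' v)|
      = ∑ v ∈ compFinset G' u, ∑ j ∈ s, |φ j (compSize G v) - φ j (compSize G' v)| := by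
        refine (Finset.sum_subset (Finset.subset_univ _) fun v _ hv => ?_).symm
        simp [h.compSize_eq hv]
    _ ≤ ∑ v ∈ compFinset G' u, (1 / (compSize G v : ℝ) + 1 / (compSize G' v : ℝ)) :=
        Finset.sum_le_sum fun v _ => hv v
    _ ≤ 3 := by
        rw [Finset.sum_add_distrib, sum_compFinset_inv_compSize]
        linarith [h.sum_inv_compSize_le_two]

end AddsEdge

end Components

/-! ### Query trees: truncated exploration, sampling, reading the whole graph -/

section Trees

namespace QueryTree

variable {n : ℕ} {G : SimpleGraph (Fin n)}

/-- Query the positions in `l` of the adjacency list of `v`, and continue with the list of the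
neighbors found there. -/
def fetch (v : Fin n) : List (Fin n) → (List (Fin n) → QueryTree n) → QueryTree n
  | [], k => k []
  | i :: l, k => neighbor v i fun o => fetch v l fun r => k (o.toList ++ r)

theorem run_fetch (L : AdjList G) (v : Fin n) (l : List (Fin n))
    (k : List (Fin n) → QueryTree n) :
    (fetch v l k).run L =
      (k (l.flatMap fun i : Fin n => ((L.nbrs v)[(i : ℕ)]?).toList)).run L := by
  induction l generalizing k with
  | nil => rfl
  | cons i l ih => simp only [fetch, run, ih, List.flatMap_cons]

theorem queries_fetch (L : AdjList G) (v : Fin n) (l : List (Fin n))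
    (k : List (Fin n) → QueryTree n) :
    (fetch v l k).queries L =
      (k (l.flatMap fun i : Fin n => ((L.nbrs v)[(i : ℕ)]?).toList)).queries L + l.length := by
  induction l generalizing k with
  | nil => rfl
  | cons i l ih => simp only [fetch, queries, ih, List.flatMap_cons, List.length_cons]; omega

theorem flatMap_range_getElem? {α : Type*} (xs : List α) (m : ℕ) :
    ((List.range m).flatMap fun i => (xs[i]?).toList) = xs.take m := by
  induction m with
  | zero => simp
  | succ m ih => rw [List.range_succ, List.flatMap_append, ih, List.take_add_one]; simp

/-- The positions below `m`. -/
def positions (n m : ℕ) : List (Fin n) := (List.finRange n).take m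

theorem length_positions_le (n m : ℕ) : (positions n m).length ≤ m := by
  simp [positions]

theorem flatMap_positions {α : Type*} (xs : List α) (m : ℕ) (h : xs.length ≤ n) :
    ((positions n m).flatMap fun i : Fin n => (xs[(i : ℕ)]?).toList) = xs.take m := by
  have h1 : (positions n m).map (fun i : Fin n => (i : ℕ)) = List.range (min m n) := by
    rw [positions, List.map_take, List.map_coe_finRange_eq_range, List.take_range]
  have h2 : ((positions n m).flatMap fun i : Fin n => (xs[(i : ℕ)]?).toList) =
      ((positions n m).map (fun i : Fin n => (i : ℕ))).flatMap fun i => (xs[i]?).toList := by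
    rw [List.flatMap_map]
  rw [h2, h1, flatMap_range_getElem?]
  rcases le_total m n with hm | hm
  · rw [min_eq_left hm]
  · rw [min_eq_right hm, List.take_of_length_le h, List.take_of_length_le (h.trans hm)]

theorem _root_.AdjList.length_nbrs_le (L : AdjList G) (v : Fin n) : (L.nbrs v).length ≤ n := by
  simpa using (L.nodup v).length_le_card

/-- The state of an exploration: the vertices found, and those whose neighbors are known. -/
abbrev Exploration (n : ℕ) := Finset (Fin n) × Finset (Fin n)

open Classical in
/-- Explore for at most `fuel` rounds. Each round picks a found vertex that has not been processed
and queries its first `k` neighbors. -/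
noncomputable def explore (k : ℕ) :
    ℕ → Exploration n → (Finset (Fin n) → QueryTree n) → QueryTree n
  | 0, st, cont => cont st.1
  | fuel + 1, st, cont =>
    if h : (st.1 \ st.2).Nonempty then
      fetch h.choose (positions n k) fun N =>
        explore k fuel (st.1 ∪ N.toFinset, insert h.choose st.2) cont
    else cont st.1

open Classical in
/-- The set of vertices found by `explore`. -/
noncomputable def found (L : AdjList G) (k : ℕ) : ℕ → Exploration n → Finset (Fin n)
  | 0, st => st.1
  | fuel + 1, st =>
    if h : (st.1 \ st.2).Nonempty then
      found L k fuel (st.1 ∪ ((L.nbrs h.choose).take k).toFinset, insert h.choose st.2)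
    else st.1

theorem run_explore (L : AdjList G) (k fuel : ℕ) (st : Exploration n)
    (cont : Finset (Fin n) → QueryTree n) :
    (explore k fuel st cont).run L = (cont (found L k fuel st)).run L := by
  induction fuel generalizing st with
  | zero => rfl
  | succ fuel ih =>
    unfold explore found
    split_ifs with h
    · rw [run_fetch, ih, flatMap_positions _ _ (L.length_nbrs_le _)]
    · rfl

theorem queries_explore (L : AdjList G) (k fuel : ℕ) (st : Exploration n)
    (cont : Finset (Fin n) → QueryTree n) :
    (explore k fuel st cont).queries L ≤ (cont (found L k fuel st)).queries L + fuel * k := by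
  induction fuel generalizing st with
  | zero => simp [explore, found]
  | succ fuel ih =>
    unfold explore found
    split_ifs with h
    · rw [queries_fetch, flatMap_positions _ _ (L.length_nbrs_le _)]
      have := ih (st.1 ∪ ((L.nbrs h.choose).take k).toFinset, insert h.choose st.2)
      have h2 := length_positions_le n k
      have h3 : (fuel + 1) * k = fuel * k + k := by ring
      omega
    · omega

theorem found_subset (L : AdjList G) (k fuel : ℕ) (st : Exploration n) (v : Fin n)
    (hst : st.1 ⊆ compFinset G v) : found L k fuel st ⊆ compFinset G v := by
  induction fuel generalizing st with
  | zero => exact hst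
  | succ fuel ih =>
    unfold found
    split_ifs with h
    · refine ih _ (Finset.union_subset hst fun x hx => ?_)
      have hx' := (L.mem_iff _ _).1 (List.mem_of_mem_take (List.mem_toFinset.1 hx))
      have hc := hst (Finset.mem_sdiff.1 h.choose_spec).1
      exact mem_compFinset.2 ((mem_compFinset.1 hc).trans hx'.reachable)
    · exact hst

theorem subset_found (L : AdjList G) (k fuel : ℕ) (st : Exploration n) :
    st.1 ⊆ found L k fuel st := by
  induction fuel generalizing st with
  | zero => exact subset_rfl
  | succ fuel ih =>
    unfold found
    split_ifs with h
    · exact fun x hx => ih _ (Finset.mem_union_left _ hx)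
    · exact subset_rfl

/-- If fewer than `k` vertices are found, then the set of found vertices is closed under
adjacency. -/
theorem found_closed (L : AdjList G) (k fuel : ℕ) (st : Exploration n) (hP : st.2 ⊆ st.1)
    (hcard : k ≤ st.2.card + fuel)
    (hclosed : ∀ a ∈ st.2, ((L.nbrs a).take k).toFinset ⊆ st.1)
    (hlt : (found L k fuel st).card < k) :
    ∀ a ∈ found L k fuel st, ∀ b, G.Adj a b → b ∈ found L k fuel st := by
  induction fuel generalizing st with
  | zero =>
    -- Without fuel at least `k` vertices have been processed, and all of them are found,
    -- contradicting `hlt`.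
    have := Finset.card_le_card hP
    simp only [found] at hlt
    omega
  | succ fuel ih =>
    unfold found at hlt ⊢
    split_ifs at hlt ⊢ with h
    · have hmem := Finset.mem_sdiff.1 h.choose_spec
      refine ih _ ?_ ?_ ?_ hlt
      · exact Finset.insert_subset (Finset.mem_union_left _ hmem.1)
          (hP.trans Finset.subset_union_left)
      · simp only [Finset.card_insert_of_notMem hmem.2]
        omega
      · intro a ha
        rcases Finset.mem_insert.1 ha with rfl | ha
        · exact Finset.subset_union_right
        · exact (hclosed a ha).trans Finset.subset_union_left
    · intro a ha b hab
      -- Every found vertex is processed. A truncated list has fewer than `k` entries, all of them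
      -- found, so it was not truncated at all.
      have hsub : st.1 ⊆ st.2 := by
        rwa [Finset.not_nonempty_iff_eq_empty, Finset.sdiff_eq_empty_iff_subset] at h
      have hN := hclosed a (hsub ha)
      have hlen : ((L.nbrs a).take k).length < k := by
        rw [← List.toFinset_card_of_nodup ((L.nodup a).sublist (List.take_sublist _ _))]
        exact (Finset.card_le_card hN).trans_lt hlt
      have htake : (L.nbrs a).take k = L.nbrs a := by
        rw [List.length_take] at hlen
        exact List.take_of_length_le (by omega)
      rw [htake] at hN
      exact hN (List.mem_toFinset.2 ((L.mem_iff a b).2 hab))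

/-- The set found by exploring from `v`. -/
noncomputable def foundFrom (L : AdjList G) (k : ℕ) (v : Fin n) : Finset (Fin n) :=
  found L k k ({v}, ∅)

theorem card_foundFrom (L : AdjList G) (k : ℕ) (v : Fin n) :
    (foundFrom L k v).card = compSize G v ∨
      k ≤ (foundFrom L k v).card ∧ k ≤ compSize G v := by
  have hsub : foundFrom L k v ⊆ compFinset G v := found_subset L k k _ v (by
    simp [mem_compFinset])
  rcases lt_or_ge (foundFrom L k v).card k with hlt | hge
  · left
    have hcl := found_closed L k k ({v}, ∅) (by simp) (by simp) (by simp) hlt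
    unfold compSize
    congr 1
    refine hsub.antisymm fun x hx => ?_
    have hr := mem_compFinset.1 hx
    rw [SimpleGraph.reachable_iff_reflTransGen] at hr
    induction hr with
    | refl => exact subset_found L k k ({v}, ∅) (by simp)
    | @tail b c hb hbc ih =>
      refine hcl b (ih ?_) c hbc
      exact mem_compFinset.2 ((SimpleGraph.reachable_iff_reflTransGen _ _).2 hb)
  · exact Or.inr ⟨hge, hge.trans (Finset.card_le_card hsub)⟩

/-- `1 / m` if `2 ^ j ≤ m < 2 ^ (j + 1)`, and `0` otherwise. -/
noncomputable def _root_.bucketInv (j m : ℕ) : ℝ := if Nat.log 2 m = j then 1 / (m : ℝ) else 0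

/-- Exploration is exact below `2^(j+1)` vertices, and `bucketInv j` vanishes from there on. So the
value does not depend on the order of the adjacency lists, although the found set may. -/
theorem bucketInv_foundFrom (L : AdjList G) (j : ℕ) (v : Fin n) :
    bucketInv j (foundFrom L (2 ^ (j + 1)) v).card = bucketInv j (compSize G v) := by
  have key : ∀ m : ℕ, 2 ^ (j + 1) ≤ m → bucketInv j m = 0 := by
    intro m hm
    have : j + 1 ≤ Nat.log 2 m := Nat.le_log_of_pow_le (by norm_num) hm
    rw [bucketInv, if_neg (by omega)]
  rcases card_foundFrom L (2 ^ (j + 1)) v with h | ⟨h₁, h₂⟩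
  · rw [h]
  · rw [key _ h₁, key _ h₂]

/-- Explore from each vertex `v` of a list of triples `(v, j, w)`, and output the sum of the values
`w * bucketInv j m`, where `m` is the size of the component of `v`, plus `x`. -/
noncomputable def sampleTree : List (Fin n × ℕ × ℝ) → ℝ → QueryTree n
  | [], x => output x
  | p :: l, x => explore (2 ^ (p.2.1 + 1)) (2 ^ (p.2.1 + 1)) ({p.1}, ∅) fun S =>
      sampleTree l (p.2.2 * bucketInv p.2.1 S.card + x)

theorem run_sampleTree (L : AdjList G) (l : List (Fin n × ℕ × ℝ)) (x : ℝ) :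
    (sampleTree l x).run L =
      (l.map fun p => p.2.2 * bucketInv p.2.1 (compSize G p.1)).sum + x := by
  induction l generalizing x with
  | nil => simp [sampleTree, run]
  | cons p l ih =>
    have := bucketInv_foundFrom L p.2.1 p.1
    unfold foundFrom at this
    rw [sampleTree, run_explore, ih, this, List.map_cons, List.sum_cons]
    ring

theorem queries_sampleTree (L : AdjList G) (l : List (Fin n × ℕ × ℝ)) (x : ℝ) :
    (sampleTree l x).queries L ≤ (l.map fun p => 4 ^ (p.2.1 + 1)).sum := by
  induction l generalizing x with
  | nil => simp [sampleTree, queries]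
  | cons p l ih =>
    rw [sampleTree, List.map_cons, List.sum_cons]
    refine (queries_explore L _ _ _ _).trans ?_
    have h4 : (4 : ℕ) ^ (p.2.1 + 1) = 2 ^ (p.2.1 + 1) * 2 ^ (p.2.1 + 1) := by
      rw [← mul_pow]; norm_num
    rw [h4, add_comm]
    exact Nat.add_le_add_left (ih _) _

/-- Query all adjacency lists of the vertices in a list, and continue with the function that
records them. -/
def readAll : List (Fin n) → (Fin n → List (Fin n)) →
    ((Fin n → List (Fin n)) → QueryTree n) → QueryTree n
  | [], f, k => k f
  | v :: l, f, k => fetch v (positions n n) fun N => readAll l (Function.update f v N) k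

theorem run_readAll (L : AdjList G) (l : List (Fin n)) (f : Fin n → List (Fin n))
    (k : (Fin n → List (Fin n)) → QueryTree n) :
    (readAll l f k).run L = (k fun v => if v ∈ l then L.nbrs v else f v).run L := by
  induction l generalizing f with
  | nil => simp [readAll]
  | cons w l ih =>
    rw [readAll, run_fetch, ih, flatMap_positions _ _ (L.length_nbrs_le _),
      List.take_of_length_le (L.length_nbrs_le _)]
    congr 2
    funext v
    by_cases hw : v = w
    · subst hw; simp
    · simp [hw]

theorem queries_readAll (L : AdjList G) (l : List (Fin n)) (f : Fin n → List (Fin n))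
    (k : (Fin n → List (Fin n)) → QueryTree n) :
    (readAll l f k).queries L ≤
      (k fun v => if v ∈ l then L.nbrs v else f v).queries L + l.length * n := by
  induction l generalizing f with
  | nil => simp [readAll]
  | cons w l ih =>
    rw [readAll, queries_fetch, flatMap_positions _ _ (L.length_nbrs_le _),
      List.take_of_length_le (L.length_nbrs_le _)]
    have h := ih (Function.update f w (L.nbrs w))
    have hf : (fun v => if v ∈ l then L.nbrs v else Function.update f w (L.nbrs w) v) =
        fun v => if v ∈ w :: l then L.nbrs v else f v := by
      funext v
      by_cases hw : v = w
      · subst hw; simp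
      · simp [hw]
    rw [hf] at h
    have h2 := length_positions_le n n
    have h3 : (w :: l).length * n = l.length * n + n := by rw [List.length_cons]; ring
    omega

/-- Read the whole graph, and output its number of components plus `x`. -/
noncomputable def exactTree (n : ℕ) (x : ℝ) : QueryTree n :=
  readAll (List.finRange n) (fun _ => []) fun f =>
    output (numComponents (SimpleGraph.fromRel fun v w => w ∈ f v) + x)

theorem run_exactTree (L : AdjList G) (x : ℝ) :
    (exactTree n x).run L = numComponents G + x := by
  have hG : (SimpleGraph.fromRel fun v w => w ∈ L.nbrs v) = G := by
    ext v w
    simp only [SimpleGraph.fromRel_adj, L.mem_iff]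
    exact ⟨fun h => h.2.elim id fun h => h.symm, fun h => ⟨h.ne, Or.inl h⟩⟩
  simp [exactTree, run_readAll, run, hG]

theorem queries_exactTree (L : AdjList G) (x : ℝ) : (exactTree n x).queries L ≤ n * n := by
  refine (queries_readAll L _ _ _).trans ?_
  simp [queries]

end QueryTree

end Trees

/-! ### Sums of independent uniform samples: stability and concentration -/

section Sampling

variable {I V : Type*} [Fintype I] [DecidableEq I] [Fintype V]

/-- Exchanging `v` with the coordinate `ω i` is an involution on pairs `(ω, v)`. -/
theorem sum_sum_update (F : (I → V) → ℝ) (i : I) :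
    ∑ ω, ∑ v, F (Function.update ω i v) = Fintype.card V * ∑ ω, F ω := by
  classical
  let e : (I → V) × V ≃ (I → V) × V :=
    { toFun := fun p => (Function.update p.1 i p.2, p.1 i)
      invFun := fun p => (Function.update p.1 i p.2, p.1 i)
      left_inv := fun p => by simp
      right_inv := fun p => by simp }
  have h1 : ∑ ω, ∑ v, F (Function.update ω i v) = ∑ p : (I → V) × V, F (e p).1 := by
    rw [Fintype.sum_prod_type]; rfl
  have h2 : ∑ p : (I → V) × V, F (e p).1 = ∑ p : (I → V) × V, F p.1 :=
    Equiv.sum_comp e fun p => F p.1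
  rw [h1, h2, Fintype.sum_prod_type, Finset.mul_sum]
  simp

/-- Resampling one summand costs a factor controlled by the average change of this summand. -/
theorem sum_shift_le {h : ℝ → ℝ} {b B : ℝ} (hb : 0 < b) (h0 : ∀ x, 0 ≤ h x)
    (hh : ∀ x y, h x ≤ Real.exp (|x - y| / b) * h y) (a a' : V → ℝ)
    (ha : ∀ v, 0 ≤ a v ∧ a v ≤ B) (ha' : ∀ v, 0 ≤ a' v ∧ a' v ≤ B) (x : ℝ) :
    ∑ v, h (x + a v) ≤
      Real.exp (Real.exp (2 * B / b) / (b * Fintype.card V) * ∑ v, |a v - a' v|) *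
        ∑ v, h (x + a' v) := by
  rcases isEmpty_or_nonempty V with hV | hV
  · simp
  set N : ℝ := (Fintype.card V : ℝ) with hN
  have hNpos : 0 < N := by rw [hN]; exact_mod_cast Fintype.card_pos
  set T := ∑ v, h (x + a' v) with hT
  have hT0 : 0 ≤ T := Finset.sum_nonneg fun v _ => h0 _
  -- All arguments lie within `B` of each other, so each value is at most `exp (B / b)` times the
  -- average. The error of one term can thus be charged to the whole sum `T`.
  have hspread : ∀ v, h (x + a' v) ≤ Real.exp (B / b) * T / N := by
    intro v
    rw [le_div_iff₀ hNpos, hT, Finset.mul_sum]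
    have : ∑ _w : V, h (x + a' v) = h (x + a' v) * N := by simp [hN, mul_comm]
    rw [← this]
    refine Finset.sum_le_sum fun w _ => (hh _ (x + a' w)).trans ?_
    refine mul_le_mul_of_nonneg_right (Real.exp_le_exp.2 ?_) (h0 _)
    gcongr
    rw [abs_le]
    constructor <;> linarith [ha' v, ha' w]
  have hstep : ∀ v, h (x + a v) ≤
      h (x + a' v) + Real.exp (2 * B / b) / (b * N) * |a v - a' v| * T := by
    intro v
    set u := |a v - a' v| / b with hu
    have hu0 : 0 ≤ u := by positivity
    have huB : u ≤ B / b := by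
      rw [hu]
      gcongr
      rw [abs_le]
      constructor <;> linarith [ha' v, ha v]
    have h1 : h (x + a v) ≤ Real.exp u * h (x + a' v) := by
      refine (hh _ (x + a' v)).trans_eq ?_
      rw [hu]; congr 4; ring
    have h2 : Real.exp u - 1 ≤ u * Real.exp (B / b) := by
      have e1 : 1 - u ≤ Real.exp (-u) := by linarith [Real.add_one_le_exp (-u)]
      have e2 : Real.exp (-u) * Real.exp u = 1 := by rw [← Real.exp_add]; simp
      have e3 : Real.exp u - 1 ≤ u * Real.exp u := by
        nlinarith [mul_le_mul_of_nonneg_right e1 (Real.exp_pos u).le]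
      exact e3.trans (mul_le_mul_of_nonneg_left (Real.exp_le_exp.2 huB) hu0)
    have h3 : (Real.exp u - 1) * h (x + a' v) ≤
        u * Real.exp (B / b) * (Real.exp (B / b) * T / N) :=
      mul_le_mul h2 (hspread v) (h0 _) (by positivity)
    have h4 : u * Real.exp (B / b) * (Real.exp (B / b) * T / N) =
        Real.exp (2 * B / b) / (b * N) * |a v - a' v| * T := by
      have : Real.exp (2 * B / b) = Real.exp (B / b) * Real.exp (B / b) := by
        rw [← Real.exp_add]; congr 1; ring
      rw [this, hu]
      field_simp
    linarith
  calc ∑ v, h (x + a v)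
      ≤ ∑ v, (h (x + a' v) + Real.exp (2 * B / b) / (b * N) * |a v - a' v| * T) :=
        Finset.sum_le_sum fun v _ => hstep v
    _ = (Real.exp (2 * B / b) / (b * N) * ∑ v, |a v - a' v| + 1) * T := by
        rw [Finset.sum_add_distrib, ← Finset.sum_mul, ← Finset.mul_sum, ← hT]; ring
    _ ≤ _ := mul_le_mul_of_nonneg_right (Real.add_one_le_exp _) hT0

/-- Replacing all summands, one at a time. -/
theorem sum_pi_shift_le {h : ℝ → ℝ} {b B : ℝ} (hb : 0 < b) (h0 : ∀ x, 0 ≤ h x)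
    (hh : ∀ x y, h x ≤ Real.exp (|x - y| / b) * h y) (a a' : I → V → ℝ)
    (ha : ∀ i v, 0 ≤ a i v ∧ a i v ≤ B) (ha' : ∀ i v, 0 ≤ a' i v ∧ a' i v ≤ B) :
    ∑ ω : I → V, h (∑ i, a i (ω i)) ≤
      Real.exp (Real.exp (2 * B / b) / (b * Fintype.card V) * ∑ i, ∑ v, |a i v - a' i v|) *
        ∑ ω : I → V, h (∑ i, a' i (ω i)) := by
  rcases isEmpty_or_nonempty V with hV | hV
  · have ht : ∀ ω : I → V, (∑ i, a i (ω i)) = ∑ i, a' i (ω i) := fun ω =>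
      Finset.sum_congr rfl fun i _ => isEmptyElim (ω i)
    simp [ht]
  have hNpos : (0 : ℝ) < Fintype.card V := by exact_mod_cast Fintype.card_pos
  set q := Real.exp (2 * B / b) / (b * Fintype.card V) with hq
  suffices H : ∀ s : Finset I, ∑ ω : I → V, h (∑ i, (if i ∈ s then a i else a' i) (ω i)) ≤
      Real.exp (q * ∑ i ∈ s, ∑ v, |a i v - a' i v|) *
        ∑ ω : I → V, h (∑ i, a' i (ω i)) by
    simpa using H Finset.univ
  intro s
  induction s using Finset.induction_on with
  | empty => simp
  | insert i s hi ih =>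
    have hrest : ∀ (s' : Finset I) (ω : I → V) (v : V),
        (∑ k, (if k ∈ s' then a k else a' k) (Function.update ω i v k)) =
          (∑ k ∈ Finset.univ.erase i, (if k ∈ s' then a k else a' k) (ω k)) +
            (if i ∈ s' then a i else a' i) v := by
      intro s' ω v
      rw [← Finset.sum_erase_add _ _ (Finset.mem_univ i), Function.update_self]
      congr 1
      refine Finset.sum_congr rfl fun k hk => ?_
      rw [Function.update_of_ne (Finset.ne_of_mem_erase hk)]
    have hsame : ∀ ω : I → V,
        (∑ k ∈ Finset.univ.erase i, (if k ∈ insert i s then a k else a' k) (ω k)) =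
          ∑ k ∈ Finset.univ.erase i, (if k ∈ s then a k else a' k) (ω k) := by
      intro ω
      refine Finset.sum_congr rfl fun k hk => ?_
      simp [Finset.ne_of_mem_erase hk]
    have hone : ∑ ω : I → V, h (∑ k, (if k ∈ insert i s then a k else a' k) (ω k)) ≤
        Real.exp (q * ∑ v, |a i v - a' i v|) *
          ∑ ω : I → V, h (∑ k, (if k ∈ s then a k else a' k) (ω k)) := by
      -- After multiplication by the number of vertices, coordinate `i` is resampled with all others
      -- frozen, so the one-summand bound applies.
      refine le_of_mul_le_mul_left ?_ hNpos
      rw [← sum_sum_update _ i, mul_left_comm, ← sum_sum_update _ i, Finset.mul_sum]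
      refine Finset.sum_le_sum fun ω _ => ?_
      simp only [hrest, hsame, Finset.mem_insert_self, if_true, if_neg hi]
      exact sum_shift_le hb h0 hh (a i) (a' i) (ha i) (ha' i) _
    refine hone.trans ((mul_le_mul_of_nonneg_left ih (Real.exp_pos _).le).trans_eq ?_)
    rw [Finset.sum_insert hi, mul_add, Real.exp_add, mul_assoc]

/-- The exponential moment factorizes over `i`, and `exp y ≤ 1 + y + y^2` for `|y| ≤ 1` bounds each
factor. Second moments replace variances, so the summands need no individual centering. -/
theorem sum_exp_le [Nonempty V] {B M S l : ℝ} (a : I → V → ℝ) (ha : ∀ i v, |a i v| ≤ B)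
    (hl : |l| * B ≤ 1) (hM : ∑ i, ∑ v, a i v = Fintype.card V * M)
    (hS : ∑ i, ∑ v, a i v ^ 2 ≤ Fintype.card V * S) :
    ∑ ω : I → V, Real.exp (l * (∑ i, a i (ω i) - M)) ≤
      Fintype.card (I → V) * Real.exp (l ^ 2 * S) := by
  have hNpos : (0 : ℝ) < Fintype.card V := by exact_mod_cast Fintype.card_pos
  set N : ℝ := (Fintype.card V : ℝ) with hN
  have hone : ∀ i, ∑ v, Real.exp (l * a i v) ≤
      N * Real.exp ((l * ∑ v, a i v + l ^ 2 * ∑ v, a i v ^ 2) / N) := by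
    intro i
    have hv : ∀ v, Real.exp (l * a i v) ≤ 1 + l * a i v + l ^ 2 * a i v ^ 2 := by
      intro v
      have h1 : |l * a i v| ≤ 1 := by
        rw [abs_mul]
        exact (mul_le_mul_of_nonneg_left (ha i v) (abs_nonneg l)).trans hl
      have := (abs_le.1 (Real.abs_exp_sub_one_sub_id_le h1)).2
      rw [mul_pow] at this
      linarith
    calc ∑ v, Real.exp (l * a i v)
        ≤ ∑ v, (1 + l * a i v + l ^ 2 * a i v ^ 2) := Finset.sum_le_sum fun v _ => hv v
      _ = N * ((l * ∑ v, a i v + l ^ 2 * ∑ v, a i v ^ 2) / N + 1) := by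
          rw [Finset.sum_add_distrib, Finset.sum_add_distrib, ← Finset.mul_sum,
            ← Finset.mul_sum]
          simp only [Finset.sum_const, Finset.card_univ, nsmul_eq_mul, mul_one]
          rw [← hN]
          field_simp
          ring
      _ ≤ _ := mul_le_mul_of_nonneg_left (Real.add_one_le_exp _) hNpos.le
  have hprod : ∑ ω : I → V, Real.exp (l * ∑ i, a i (ω i)) = ∏ i, ∑ v, Real.exp (l * a i v) := by
    rw [Finset.prod_univ_sum, Fintype.piFinset_univ]
    refine Finset.sum_congr rfl fun ω _ => ?_
    rw [Finset.mul_sum, Real.exp_sum]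
  have hsum : ∑ i, (l * ∑ v, a i v + l ^ 2 * ∑ v, a i v ^ 2) / N ≤ l * M + l ^ 2 * S := by
    rw [← Finset.sum_div, Finset.sum_add_distrib, ← Finset.mul_sum, ← Finset.mul_sum, hM,
      div_le_iff₀ hNpos]
    nlinarith [mul_le_mul_of_nonneg_left hS (sq_nonneg l)]
  have hle : ∑ ω : I → V, Real.exp (l * ∑ i, a i (ω i)) ≤
      Fintype.card (I → V) * Real.exp (l * M + l ^ 2 * S) := by
    rw [hprod]
    calc ∏ i, ∑ v, Real.exp (l * a i v)
        ≤ ∏ i, (N * Real.exp ((l * ∑ v, a i v + l ^ 2 * ∑ v, a i v ^ 2) / N)) :=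
          Finset.prod_le_prod (fun i _ => Finset.sum_nonneg fun v _ => (Real.exp_pos _).le)
            fun i _ => hone i
      _ = N ^ Fintype.card I *
            Real.exp (∑ i, (l * ∑ v, a i v + l ^ 2 * ∑ v, a i v ^ 2) / N) := by
          rw [Finset.prod_mul_distrib, Real.exp_sum]; simp
      _ ≤ _ := by
          rw [Fintype.card_fun, Nat.cast_pow, ← hN]
          exact mul_le_mul_of_nonneg_left (Real.exp_le_exp.2 hsum) (by positivity)
  calc ∑ ω : I → V, Real.exp (l * (∑ i, a i (ω i) - M))
      = Real.exp (-(l * M)) * ∑ ω : I → V, Real.exp (l * ∑ i, a i (ω i)) := by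
        rw [Finset.mul_sum]
        refine Finset.sum_congr rfl fun ω _ => ?_
        rw [← Real.exp_add]; congr 1; ring
    _ ≤ Real.exp (-(l * M)) * (Fintype.card (I → V) * Real.exp (l * M + l ^ 2 * S)) :=
        mul_le_mul_of_nonneg_left hle (Real.exp_pos _).le
    _ = _ := by
        rw [mul_left_comm, ← Real.exp_add]; congr 2; ring

open Classical in
/-- A Bernstein bound for sums of independent uniform samples, by counting. -/
theorem card_tail_le [Nonempty V] {B M S l r : ℝ} (a : I → V → ℝ) (ha : ∀ i v, |a i v| ≤ B)
    (hl0 : 0 ≤ l) (hl : l * B ≤ 1) (hM : ∑ i, ∑ v, a i v = Fintype.card V * M)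
    (hS : ∑ i, ∑ v, a i v ^ 2 ≤ Fintype.card V * S) :
    ((Finset.univ.filter fun ω : I → V => r < |∑ i, a i (ω i) - M|).card : ℝ) ≤
      2 * Real.exp (-(l * r) + l ^ 2 * S) * Fintype.card (I → V) := by
  have h1 := sum_exp_le a ha (by rwa [abs_of_nonneg hl0]) hM hS
  have h2 := sum_exp_le (l := -l) a ha (by rwa [abs_neg, abs_of_nonneg hl0]) hM hS
  rw [neg_sq] at h2
  set bad := Finset.univ.filter fun ω : I → V => r < |∑ i, a i (ω i) - M| with hbad
  have h3 : (bad.card : ℝ) * Real.exp (l * r) ≤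
      ∑ ω : I → V, (Real.exp (l * (∑ i, a i (ω i) - M)) +
        Real.exp (-l * (∑ i, a i (ω i) - M))) := by
    rw [← nsmul_eq_mul]
    refine (Finset.card_nsmul_le_sum bad _ _ fun ω hω => ?_).trans
      (Finset.sum_le_sum_of_subset_of_nonneg (Finset.subset_univ _) fun ω _ _ => by positivity)
    have hr : r < |∑ i, a i (ω i) - M| := (Finset.mem_filter.1 hω).2
    rcases lt_abs.1 hr with h | h
    · refine le_add_of_le_of_nonneg (Real.exp_le_exp.2 ?_) (Real.exp_pos _).le
      exact mul_le_mul_of_nonneg_left h.le hl0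
    · refine le_add_of_nonneg_of_le (Real.exp_pos _).le (Real.exp_le_exp.2 ?_)
      nlinarith [mul_le_mul_of_nonneg_left h.le hl0]
  rw [Finset.sum_add_distrib] at h3
  have h4 : (bad.card : ℝ) * Real.exp (l * r) ≤
      2 * Fintype.card (I → V) * Real.exp (l ^ 2 * S) := by linarith
  have h5 : (bad.card : ℝ) = bad.card * Real.exp (l * r) * Real.exp (-(l * r)) := by
    rw [mul_assoc, ← Real.exp_add]; simp
  rw [h5, Real.exp_add]
  nlinarith [mul_le_mul_of_nonneg_right h4 (Real.exp_pos (-(l * r))).le]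

end Sampling

/-! ### The Laplace distribution -/

section Laplace

/-- The centered Laplace distribution of scale `b`. -/
noncomputable def laplace (b : ℝ) : Measure ℝ :=
  volume.withDensity fun z => ENNReal.ofReal (Real.exp (-|z| / b) / (2 * b))

theorem laplace_Ioi {b t : ℝ} (hb : 0 < b) (ht : 0 ≤ t) :
    laplace b (Set.Ioi t) = ENNReal.ofReal (Real.exp (-t / b) / 2) := by
  have hneg : -1 / b < 0 := div_neg_of_neg_of_pos (by norm_num) hb
  rw [laplace, withDensity_apply _ measurableSet_Ioi]
  have hcongr : ∫⁻ z in Set.Ioi t, ENNReal.ofReal (Real.exp (-|z| / b) / (2 * b)) =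
      ∫⁻ z in Set.Ioi t, ENNReal.ofReal (Real.exp (-1 / b * z) / (2 * b)) := by
    refine setLIntegral_congr_fun measurableSet_Ioi fun z hz => ?_
    have hz' : 0 < z := ht.trans_lt hz
    simp only [abs_of_pos hz']
    congr 3; ring
  rw [hcongr, ← ofReal_integral_eq_lintegral_ofReal
    ((integrableOn_exp_mul_Ioi hneg t).div_const _)
    (Filter.Eventually.of_forall fun z => by positivity), integral_div,
    integral_exp_mul_Ioi hneg]
  congr 1
  rw [show -1 / b * t = -t / b by ring]
  field_simp

theorem laplace_Iic {b t : ℝ} (hb : 0 < b) (ht : 0 ≤ t) :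
    laplace b (Set.Iic (-t)) = ENNReal.ofReal (Real.exp (-t / b) / 2) := by
  have hpos : 0 < 1 / b := by positivity
  rw [laplace, withDensity_apply _ measurableSet_Iic]
  have hcongr : ∫⁻ z in Set.Iic (-t), ENNReal.ofReal (Real.exp (-|z| / b) / (2 * b)) =
      ∫⁻ z in Set.Iic (-t), ENNReal.ofReal (Real.exp (1 / b * z) / (2 * b)) := by
    refine setLIntegral_congr_fun measurableSet_Iic fun z hz => ?_
    have hz' : z ≤ 0 := le_trans hz (by linarith)
    simp only [abs_of_nonpos hz']
    congr 3; ring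
  rw [hcongr, ← ofReal_integral_eq_lintegral_ofReal
    ((integrableOn_exp_mul_Iic hpos _).div_const _)
    (Filter.Eventually.of_forall fun z => by positivity), integral_div,
    integral_exp_mul_Iic hpos]
  congr 1
  rw [show 1 / b * -t = -t / b by ring]
  field_simp

theorem isProbabilityMeasure_laplace {b : ℝ} (hb : 0 < b) :
    IsProbabilityMeasure (laplace b) := by
  constructor
  rw [← Set.Iic_union_Ioi (a := (0 : ℝ)),
    measure_union (Set.Iic_disjoint_Ioi le_rfl) measurableSet_Ioi, laplace_Ioi hb le_rfl]
  have := laplace_Iic hb (le_refl 0)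
  rw [neg_zero] at this
  rw [this, ← ENNReal.ofReal_add (by positivity) (by positivity)]
  norm_num

theorem one_sub_le_laplace_real_Icc {b t : ℝ} (hb : 0 < b) (ht : 0 ≤ t) :
    1 - Real.exp (-t / b) ≤ (laplace b).real (Set.Icc (-t) t) := by
  have := isProbabilityMeasure_laplace hb
  have h1 : (laplace b).real (Set.Icc (-t) t)ᶜ ≤ Real.exp (-t / b) := by
    have hsub : (Set.Icc (-t) t)ᶜ ⊆ Set.Iic (-t) ∪ Set.Ioi t := by
      intro z hz
      simp only [Set.mem_compl_iff, Set.mem_Icc, not_and_or, not_le] at hz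
      exact hz.imp le_of_lt id
    refine (measureReal_mono hsub).trans ((measureReal_union_le _ _).trans ?_)
    rw [measureReal_def, measureReal_def, laplace_Ioi hb ht, laplace_Iic hb ht,
      ENNReal.toReal_ofReal (by positivity)]
    linarith
  have h2 := probReal_compl_eq_one_sub (μ := laplace b) (s := Set.Icc (-t) t) measurableSet_Icc
  linarith

theorem laplace_preimage_add {b : ℝ} (x : ℝ) {S : Set ℝ} (hS : MeasurableSet S) :
    laplace b ((fun z => x + z) ⁻¹' S) =
      ∫⁻ y in S, ENNReal.ofReal (Real.exp (-|y - x| / b) / (2 * b)) := by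
  have hS' : MeasurableSet ((fun z => x + z) ⁻¹' S) := (measurable_const_add x) hS
  rw [laplace, withDensity_apply _ hS', ← lintegral_indicator hS', ← lintegral_indicator hS,
    ← lintegral_add_left_eq_self (S.indicator _) x]
  refine lintegral_congr fun z => ?_
  simp only [Set.indicator, add_sub_cancel_left]
  rfl

end Laplace

/-! ### A randomized statistic with Laplace noise -/

section NoisyAlg

variable {n : ℕ} {Ω : Type} [Fintype Ω] [Nonempty Ω] [MeasurableSpace Ω]
  [DiscreteMeasurableSpace Ω] {b : ℝ} {tree : Ω → ℝ → QueryTree n}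
  {val : SimpleGraph (Fin n) → Ω → ℝ}

/-- The algorithm that evaluates a statistic with finitely many equally likely random choices
`ω : Ω`, and adds independent Laplace noise. -/
noncomputable def noisyAlg (hb : 0 < b)
    (hrun : ∀ (G : SimpleGraph (Fin n)) (L : AdjList G) ω z, (tree ω z).run L = val G ω + z) :
    RandQueryAlg n where
  Coins := Ω × ℝ
  mCoins := inferInstance
  P := (PMF.uniformOfFintype Ω).toMeasure.prod (laplace b)
  isProb := by
    have := isProbabilityMeasure_laplace hb
    infer_instance
  tree := fun p => tree p.1 p.2
  measurable_run := fun G L => by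
    simp only [hrun]
    exact (Measurable.comp (Measurable.of_discrete (f := val G)) measurable_fst).add
      measurable_snd

variable (hb : 0 < b)
  (hrun : ∀ (G : SimpleGraph (Fin n)) (L : AdjList G) ω z, (tree ω z).run L = val G ω + z)

theorem noisyAlg_law_apply {G : SimpleGraph (Fin n)} (L : AdjList G) {S : Set ℝ}
    (hS : MeasurableSet S) :
    (noisyAlg hb hrun).law L S =
      ∑ ω, laplace b ((fun z => val G ω + z) ⁻¹' S) * (Fintype.card Ω : ENNReal)⁻¹ := by
  have := isProbabilityMeasure_laplace hb
  have hm := (noisyAlg hb hrun).measurable_run G L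
  have hmS : MeasurableSet ((fun p : Ω × ℝ => (tree p.1 p.2).run L) ⁻¹' S) := hm hS
  rw [RandQueryAlg.law, @Measure.map_apply _ _ (noisyAlg hb hrun).mCoins _ _ _ hm _ hS]
  change (PMF.uniformOfFintype Ω).toMeasure.prod (laplace b)
    ((fun p : Ω × ℝ => (tree p.1 p.2).run L) ⁻¹' S) = _
  rw [Measure.prod_apply hmS, lintegral_fintype]
  refine Finset.sum_congr rfl fun ω _ => ?_
  rw [PMF.toMeasure_apply_singleton _ _ (measurableSet_singleton ω),
    PMF.uniformOfFintype_apply]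
  congr 2
  ext z
  simp [hrun]

/-- The output density is the average over `ω` of shifted Laplace densities, so a pointwise
comparison of these sums suffices. -/
theorem noisyAlg_isEdgeDP {ε : ℝ}
    (h : ∀ G₁ G₂ : SimpleGraph (Fin n), EdgeNeighboring G₁ G₂ → ∀ y,
      ∑ ω, Real.exp (-|y - val G₁ ω| / b) ≤
        Real.exp ε * ∑ ω, Real.exp (-|y - val G₂ ω| / b)) :
    (noisyAlg hb hrun).IsEdgeDP ε := by
  intro G₁ G₂ hG L₁ L₂ S hS
  have hlaw : ∀ (G : SimpleGraph (Fin n)) (L : AdjList G), (noisyAlg hb hrun).law L S =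
      (∫⁻ y in S, ENNReal.ofReal ((∑ ω, Real.exp (-|y - val G ω| / b)) / (2 * b))) *
        (Fintype.card Ω : ENNReal)⁻¹ := by
    intro G L
    rw [noisyAlg_law_apply hb hrun L hS, ← Finset.sum_mul]
    congr 1
    simp only [laplace_preimage_add _ hS]
    rw [← lintegral_finsetSum]
    · refine lintegral_congr fun y => ?_
      rw [Finset.sum_div, ENNReal.ofReal_sum_of_nonneg fun ω _ => by positivity]
    · intro ω _
      fun_prop
  rw [hlaw, hlaw, ← mul_assoc]
  gcongr
  rw [← lintegral_const_mul']
  · refine lintegral_mono fun y => ?_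
    rw [← ENNReal.ofReal_mul (Real.exp_pos _).le, ← mul_div_assoc]
    exact ENNReal.ofReal_le_ofReal (div_le_div_of_nonneg_right (h G₁ G₂ hG y) (by positivity))
  · exact ENNReal.ofReal_ne_top

open Classical in
theorem noisyAlg_accuracy {G : SimpleGraph (Fin n)} (L : AdjList G) {M E r t δ : ℝ}
    (ht : 0 ≤ t) (hE : r + t ≤ E)
    (hbad : ((Finset.univ.filter fun ω => r < |val G ω - M|).card : ℝ) ≤ δ * Fintype.card Ω) :
    1 - δ - Real.exp (-t / b) ≤ ((noisyAlg hb hrun).law L).real (Set.Icc (M - E) (M + E)) := by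
  have := isProbabilityMeasure_laplace hb
  have hNpos : (0 : ℝ) < Fintype.card Ω := by exact_mod_cast Fintype.card_pos
  have hreal : ((noisyAlg hb hrun).law L).real (Set.Icc (M - E) (M + E)) =
      (∑ ω, (laplace b).real ((fun z => val G ω + z) ⁻¹' Set.Icc (M - E) (M + E))) /
        Fintype.card Ω := by
    rw [measureReal_def, noisyAlg_law_apply hb hrun L measurableSet_Icc, ← Finset.sum_mul,
      ENNReal.toReal_mul, ENNReal.toReal_sum fun ω _ => measure_ne_top _ _, ENNReal.toReal_inv,
      ENNReal.toReal_natCast]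
    rfl
  have hτ : Real.exp (-t / b) ≤ 1 := by
    rw [Real.exp_le_one_iff]
    exact div_nonpos_of_nonpos_of_nonneg (by linarith) hb.le
  set τ := Real.exp (-t / b)
  set bad := Finset.univ.filter fun ω => r < |val G ω - M| with hbad_def
  -- For bad `ω` the left side is `-τ`, which is trivial; for good `ω` it suffices that the noise
  -- has size at most `t`.
  have hterm : ∀ ω, (1 - τ) - (if ω ∈ bad then 1 else 0) ≤
      (laplace b).real ((fun z => val G ω + z) ⁻¹' Set.Icc (M - E) (M + E)) := by
    intro ω
    split_ifs with hω
    · have : 0 ≤ (laplace b).real ((fun z => val G ω + z) ⁻¹' Set.Icc (M - E) (M + E)) :=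
        measureReal_nonneg
      have := Real.exp_pos (-t / b)
      linarith
    · have hgood : |val G ω - M| ≤ r := by simpa [hbad_def] using hω
      rw [abs_le] at hgood
      rw [sub_zero]
      refine (one_sub_le_laplace_real_Icc hb ht).trans (measureReal_mono fun z hz => ?_)
      simp only [Set.mem_preimage, Set.mem_Icc] at hz ⊢
      constructor <;> linarith [hz.1, hz.2]
  rw [hreal, le_div_iff₀ hNpos]
  refine le_trans ?_ (Finset.sum_le_sum fun ω _ => hterm ω)
  rw [Finset.sum_sub_distrib, Finset.sum_const, Finset.card_univ, nsmul_eq_mul,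
    Finset.sum_ite_mem, Finset.univ_inter, Finset.sum_const, nsmul_eq_mul, mul_one]
  linarith

end NoisyAlg

/-! ### Laplace density ratios and the algorithms without sampling -/

theorem exp_neg_abs_div_le {b : ℝ} (hb : 0 < b) (y x x' : ℝ) :
    Real.exp (-|y - x| / b) ≤ Real.exp (|x - x'| / b) * Real.exp (-|y - x'| / b) := by
  rw [← Real.exp_add, Real.exp_le_exp, ← add_div]
  refine div_le_div_of_nonneg_right ?_ hb.le
  have := abs_sub_le y x x'
  linarith

/-- A constant output, without queries. -/
theorem exists_constAlg (n : ℕ) (x : ℝ) {ε : ℝ} (hε : 0 < ε) :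
    ∃ A : RandQueryAlg n, A.IsEdgeDP ε ∧
      (∀ (G : SimpleGraph (Fin n)) (L : AdjList G) (lo hi : ℝ), lo ≤ x → x ≤ hi →
        (A.law L).real (Set.Icc lo hi) = 1) ∧
      ∀ (G : SimpleGraph (Fin n)) (L : AdjList G) (ω : A.Coins), (A.tree ω).queries L = 0 := by
  let A : RandQueryAlg n :=
    { Coins := Unit
      mCoins := inferInstance
      P := Measure.dirac ()
      isProb := inferInstance
      tree := fun _ => QueryTree.output x
      measurable_run := fun _ _ => measurable_const }
  have hlaw : ∀ (G : SimpleGraph (Fin n)) (L : AdjList G), A.law L = Measure.dirac x := by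
    intro G L
    exact Measure.map_dirac (f := fun _ : Unit => x) ()
  refine ⟨A, ?_, ?_, fun _ _ _ => rfl⟩
  · intro G₁ G₂ _ L₁ L₂ S _
    rw [hlaw, hlaw]
    refine le_mul_of_one_le_left (zero_le) ?_
    rw [ENNReal.one_le_ofReal]
    exact Real.one_le_exp hε.le
  · intro G L lo hi h₁ h₂
    rw [hlaw, measureReal_def, Measure.dirac_apply' _ measurableSet_Icc]
    simp [h₁, h₂]

/-- The exact number of components with Laplace noise. -/
theorem exists_exactAlg (n : ℕ) {ε : ℝ} (hε : 0 < ε) :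
    ∃ A : RandQueryAlg n, A.IsEdgeDP ε ∧
      (∀ (G : SimpleGraph (Fin n)) (L : AdjList G) (t E : ℝ), 0 ≤ t → t ≤ E →
        1 - Real.exp (-t / (1 / ε)) ≤
          (A.law L).real (Set.Icc ((numComponents G : ℝ) - E) ((numComponents G : ℝ) + E))) ∧
      ∀ (G : SimpleGraph (Fin n)) (L : AdjList G) (ω : A.Coins),
        (A.tree ω).queries L ≤ n * n := by
  have hb : 0 < 1 / ε := by positivity
  let val : SimpleGraph (Fin n) → Unit → ℝ := fun G _ => numComponents G
  have hrun : ∀ (G : SimpleGraph (Fin n)) (L : AdjList G) (ω : Unit) z,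
      ((fun _ z => QueryTree.exactTree n z : Unit → ℝ → QueryTree n) ω z).run L = val G ω + z :=
    fun G L _ z => QueryTree.run_exactTree L z
  refine ⟨noisyAlg hb hrun, noisyAlg_isEdgeDP hb hrun ?_, ?_, ?_⟩
  · intro G₁ G₂ hG y
    have hdiff : |(numComponents G₁ : ℝ) - numComponents G₂| ≤ 1 := by
      rcases hG.cases with rfl | ⟨u, w, h⟩ | ⟨u, w, h⟩
      · simp
      · exact h.abs_numComponents_sub_le
      · rw [abs_sub_comm]; exact h.abs_numComponents_sub_le
    simp only [Finset.univ_unique, Finset.sum_singleton, val]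
    refine (exp_neg_abs_div_le hb y _ (numComponents G₂)).trans ?_
    refine mul_le_mul_of_nonneg_right (Real.exp_le_exp.2 ?_) (Real.exp_pos _).le
    rw [div_div_eq_mul_div, div_one]
    nlinarith
  · intro G L t E ht hE
    have := noisyAlg_accuracy hb hrun L (M := numComponents G) (E := E) (r := 0) (δ := 0) ht
      (by linarith) (by simp [val])
    linarith
  · intro G L ω
    exact QueryTree.queries_exactTree L _

/-! ### The dyadic decomposition -/

theorem bucketInv_nonneg (j m : ℕ) : 0 ≤ bucketInv j m := by
  unfold bucketInv; split_ifs <;> positivity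

/-- The indicator is kept because each vertex then counts on at most one level, which keeps a factor
`J` out of the second moment. -/
theorem bucketInv_le (j m : ℕ) : bucketInv j m ≤ (if Nat.log 2 m = j then 1 else 0) / 2 ^ j := by
  unfold bucketInv
  split_ifs with h
  · rcases Nat.eq_zero_or_pos m with rfl | hm
    · simp
    · have : 2 ^ j ≤ m := by rw [← h]; exact Nat.pow_log_le_self 2 hm.ne'
      exact one_div_le_one_div_of_le (by positivity) (by exact_mod_cast this)
  · simp

theorem sum_bucketInv (J m : ℕ) :
    ∑ j : Fin J, bucketInv j m = if Nat.log 2 m < J then 1 / (m : ℝ) else 0 := by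
  rw [Fin.sum_univ_eq_sum_range (fun j => bucketInv j m)]
  simp [bucketInv]

theorem sum_bucketInv_le (J m : ℕ) : ∑ j : Fin J, bucketInv j m ≤ 1 / (m : ℝ) := by
  rw [sum_bucketInv]
  split_ifs
  · exact le_rfl
  · positivity

/-- Components of size at least `2 ^ J` contribute little to the number of components. -/
theorem abs_sum_bucketInv_sub_numComponents_le {n : ℕ} (G : SimpleGraph (Fin n)) (J : ℕ) :
    |(∑ v, ∑ j : Fin J, bucketInv j (compSize G v)) - numComponents G| ≤ n / 2 ^ J := by
  rw [numComponents_eq_sum, ← Finset.sum_sub_distrib]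
  refine (Finset.abs_sum_le_sum_abs _ _).trans ?_
  have hv : ∀ v ∈ (Finset.univ : Finset (Fin n)),
      |∑ j : Fin J, bucketInv j (compSize G v) - 1 / (compSize G v : ℝ)| ≤ 1 / 2 ^ J := by
    intro v _
    rw [sum_bucketInv]
    split_ifs with h
    · rw [sub_self, abs_zero]; positivity
    · rw [zero_sub, abs_neg, abs_of_nonneg (by positivity)]
      refine one_div_le_one_div_of_le (by positivity) ?_
      have : 2 ^ J ≤ compSize G v :=
        (Nat.pow_le_pow_right (by norm_num) (not_lt.1 h)).trans
          (Nat.pow_log_le_self 2 (compSize_pos G v).ne')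
      exact_mod_cast this
  refine (Finset.sum_le_card_nsmul _ _ _ hv).trans_eq ?_
  simp [div_eq_mul_inv]

/-! ### The sampling estimator -/

section SampledAlg

variable {n J m : ℕ}

/-- The number of samples of level `j`. -/
def levelSamples (J m j : ℕ) : ℕ := m * 4 ^ (J - 1 - j)

/-- The samples, each with its level. -/
abbrev SampleIndex (J m : ℕ) := Σ j : Fin J, Fin (levelSamples J m j)

/-- The contribution of a sample of level `j` at the vertex `v`. -/
noncomputable def sampleValue (m : ℕ) (G : SimpleGraph (Fin n)) (j : Fin J) (v : Fin n) : ℝ :=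
  n / levelSamples J m j * bucketInv j (compSize G v)

theorem sum_sampleIndex (F : Fin J → ℝ) :
    ∑ i : SampleIndex J m, F i.1 = ∑ j : Fin J, (levelSamples J m j : ℝ) * F j := by
  rw [Fintype.sum_sigma]
  simp

theorem two_pow_eq (j : Fin J) : (2 : ℝ) ^ J = 2 * 2 ^ (j : ℕ) * 2 ^ (J - 1 - j) := by
  rw [mul_assoc, ← pow_add, ← pow_succ']
  congr 1
  omega

theorem levelSamples_cast (j : Fin J) :
    (levelSamples J m j : ℝ) = m * (2 ^ (J - 1 - (j : ℕ))) ^ 2 := by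
  rw [levelSamples, ← pow_mul, mul_comm (J - 1 - (j : ℕ)) 2, pow_mul]
  push_cast
  norm_num

theorem levelSamples_pos (hm : 0 < m) (j : Fin J) : (0 : ℝ) < levelSamples J m j := by
  rw [levelSamples_cast]
  positivity

theorem sampleValue_nonneg (G : SimpleGraph (Fin n)) (j : Fin J) (v : Fin n) :
    0 ≤ sampleValue m G j v :=
  mul_nonneg (by positivity) (bucketInv_nonneg _ _)

/-- With `p = 2^j` and `q = 2^(J-1-j)`, the value is at most `n / (m * q^2 * p)`, while `2^J = 2 * p
* q`; the top level, `q = 1`, is the worst. -/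
theorem sampleValue_le (hm : 0 < m) (G : SimpleGraph (Fin n)) (j : Fin J) (v : Fin n) :
    sampleValue m G j v ≤ 2 * n / (m * 2 ^ J) := by
  have h1 : bucketInv j (compSize G v) ≤ 1 / 2 ^ (j : ℕ) := by
    refine (bucketInv_le _ _).trans ?_
    gcongr
    split_ifs <;> norm_num
  refine (mul_le_mul_of_nonneg_left h1 (by positivity)).trans ?_
  rw [levelSamples_cast, two_pow_eq j]
  have hq : (1 : ℝ) ≤ 2 ^ (J - 1 - (j : ℕ)) := one_le_pow₀ (by norm_num)
  set p : ℝ := 2 ^ (j : ℕ)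
  set q : ℝ := 2 ^ (J - 1 - (j : ℕ))
  have hp : 0 < p := by positivity
  have hm' : (0 : ℝ) < m := by exact_mod_cast hm
  have e1 : (n : ℝ) / (m * q ^ 2) * (1 / p) = n / (m * p * q) * (1 / q) := by
    field_simp
  have e2 : 2 * (n : ℝ) / (m * (2 * p * q)) = n / (m * p * q) * 1 := by
    field_simp
  rw [e1, e2]
  refine mul_le_mul_of_nonneg_left ?_ (by positivity)
  rw [div_le_one (by linarith)]
  exact hq

theorem sum_sampleValue (hm : 0 < m) (G : SimpleGraph (Fin n)) :
    ∑ i : SampleIndex J m, ∑ v, sampleValue m G i.1 v =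
      n * ∑ v, ∑ j : Fin J, bucketInv j (compSize G v) := by
  rw [sum_sampleIndex (fun j => ∑ v, sampleValue m G j v), Finset.sum_comm, Finset.mul_sum]
  refine Finset.sum_congr rfl fun j _ => ?_
  have := levelSamples_pos hm j
  simp only [sampleValue]
  rw [← Finset.mul_sum]
  field_simp

/-- A vertex on level `j` contributes at most `n^2 / (levelSamples J m j * 4^j)`, which is the same
for every `j`. -/
theorem sum_sampleValue_sq_le (hm : 0 < m) (G : SimpleGraph (Fin n)) :
    ∑ i : SampleIndex J m, ∑ v, sampleValue m G i.1 v ^ 2 ≤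
      n * (4 * (n : ℝ) ^ 2 / (m * (2 ^ J) ^ 2)) := by
  have hm' : (0 : ℝ) < m := by exact_mod_cast hm
  rw [sum_sampleIndex (fun j => ∑ v, sampleValue m G j v ^ 2)]
  have hterm : ∀ (j : Fin J) (v : Fin n), (levelSamples J m j : ℝ) * sampleValue m G j v ^ 2 ≤
      4 * (n : ℝ) ^ 2 / (m * (2 ^ J) ^ 2) *
        if Nat.log 2 (compSize G v) = j then 1 else 0 := by
    intro j v
    have h1 := bucketInv_le j (compSize G v)
    have h2 : bucketInv j (compSize G v) ^ 2 ≤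
        (if Nat.log 2 (compSize G v) = j then 1 else 0) / (2 ^ (j : ℕ)) ^ 2 := by
      refine (pow_le_pow_left₀ (bucketInv_nonneg _ _) h1 2).trans_eq ?_
      rw [div_pow]
      split_ifs <;> simp
    have hs := levelSamples_pos hm j
    calc (levelSamples J m j : ℝ) * sampleValue m G j v ^ 2
        = (n : ℝ) ^ 2 / levelSamples J m j * bucketInv j (compSize G v) ^ 2 := by
          rw [sampleValue]; field_simp
      _ ≤ (n : ℝ) ^ 2 / levelSamples J m j *
          ((if Nat.log 2 (compSize G v) = j then 1 else 0) / (2 ^ (j : ℕ)) ^ 2) :=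
          mul_le_mul_of_nonneg_left h2 (by positivity)
      _ = _ := by
          rw [levelSamples_cast, two_pow_eq j]
          field_simp
          ring
  have hcount : ∀ v : Fin n,
      ∑ j : Fin J, (if Nat.log 2 (compSize G v) = (j : ℕ) then (1 : ℝ) else 0) ≤ 1 := by
    intro v
    rw [Fin.sum_univ_eq_sum_range
      (fun j => if Nat.log 2 (compSize G v) = j then (1 : ℝ) else 0), Finset.sum_ite_eq]
    split_ifs <;> norm_num
  calc ∑ j : Fin J, (levelSamples J m j : ℝ) * ∑ v, sampleValue m G j v ^ 2
      ≤ ∑ j : Fin J, ∑ v : Fin n, 4 * (n : ℝ) ^ 2 / (m * (2 ^ J) ^ 2) *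
        (if Nat.log 2 (compSize G v) = (j : ℕ) then (1 : ℝ) else 0) := by
        refine Finset.sum_le_sum fun j _ => ?_
        rw [Finset.mul_sum]
        exact Finset.sum_le_sum fun v _ => hterm j v
    _ = 4 * (n : ℝ) ^ 2 / (m * (2 ^ J) ^ 2) * ∑ v : Fin n, ∑ j : Fin J,
        (if Nat.log 2 (compSize G v) = (j : ℕ) then (1 : ℝ) else 0) := by
        rw [Finset.sum_comm, Finset.mul_sum]
        refine Finset.sum_congr rfl fun v _ => ?_
        rw [Finset.mul_sum]
    _ ≤ 4 * (n : ℝ) ^ 2 / (m * (2 ^ J) ^ 2) * ∑ _v : Fin n, 1 :=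
        mul_le_mul_of_nonneg_left (Finset.sum_le_sum fun v _ => hcount v) (by positivity)
    _ = _ := by simp [mul_comm]

theorem sum_abs_sampleValue_sub_le (hm : 0 < m) {G₁ G₂ : SimpleGraph (Fin n)}
    (hG : EdgeNeighboring G₁ G₂) :
    ∑ i : SampleIndex J m, ∑ v, |sampleValue m G₁ i.1 v - sampleValue m G₂ i.1 v| ≤
      n * 3 := by
  rw [sum_sampleIndex (fun j => ∑ v, |sampleValue m G₁ j v - sampleValue m G₂ j v|)]
  have h1 : ∀ j : Fin J, (levelSamples J m j : ℝ) *
      ∑ v, |sampleValue m G₁ j v - sampleValue m G₂ j v| =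
        n * ∑ v, |bucketInv j (compSize G₁ v) - bucketInv j (compSize G₂ v)| := by
    intro j
    have hs := levelSamples_pos hm j
    simp only [sampleValue, ← mul_sub, abs_mul]
    rw [← Finset.mul_sum, abs_of_nonneg (by positivity)]
    field_simp
  rw [Finset.sum_congr rfl fun j _ => h1 j, ← Finset.mul_sum]
  refine mul_le_mul_of_nonneg_left ?_ (by positivity)
  have hnn : ∀ (j : Fin J) k, 0 ≤ bucketInv j k := fun j k => bucketInv_nonneg j k
  rcases hG.cases with rfl | ⟨u, w, h⟩ | ⟨u, w, h⟩
  · simp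
  · exact h.sum_abs_sub_le Finset.univ (fun j : Fin J => bucketInv j) hnn (sum_bucketInv_le J)
  · simp only [abs_sub_comm (bucketInv _ (compSize G₁ _))]
    exact h.sum_abs_sub_le Finset.univ (fun j : Fin J => bucketInv j) hnn (sum_bucketInv_le J)

/-- The estimate from samples of component sizes at `J` scales, with Laplace noise. -/
theorem exists_sampledAlg (n J m : ℕ) (hn : 0 < n) (hm : 0 < m) {b ε : ℝ} (hb : 0 < b)
    (hε : 3 * Real.exp (2 * (2 * n / (m * 2 ^ J)) / b) / b ≤ ε) :
    ∃ A : RandQueryAlg n, A.IsEdgeDP ε ∧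
      (∀ (G : SimpleGraph (Fin n)) (L : AdjList G) (r t l E : ℝ), 0 ≤ t → 0 ≤ l →
        l * (2 * n / (m * 2 ^ J)) ≤ 1 → n / 2 ^ J + r + t ≤ E →
        1 - 2 * Real.exp (-(l * r) + l ^ 2 * (4 * (n : ℝ) ^ 2 / (m * (2 ^ J) ^ 2))) -
            Real.exp (-t / b) ≤
          (A.law L).real (Set.Icc ((numComponents G : ℝ) - E) ((numComponents G : ℝ) + E))) ∧
      ∀ (G : SimpleGraph (Fin n)) (L : AdjList G) (ω : A.Coins),
        (A.tree ω).queries L ≤ J * (m * 4 ^ J) := by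
  classical
  have hNe : Nonempty (Fin n) := ⟨⟨0, hn⟩⟩
  have hn' : (0 : ℝ) < n := by exact_mod_cast hn
  let samples : (SampleIndex J m → Fin n) → List (Fin n × ℕ × ℝ) := fun ω =>
    (Finset.univ : Finset (SampleIndex J m)).toList.map fun i =>
      (ω i, (i.1 : ℕ), (n : ℝ) / levelSamples J m i.1)
  let val : SimpleGraph (Fin n) → (SampleIndex J m → Fin n) → ℝ := fun G ω =>
    ∑ i, sampleValue m G i.1 (ω i)
  have hrun : ∀ (G : SimpleGraph (Fin n)) (L : AdjList G) (ω : SampleIndex J m → Fin n) z,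
      ((fun ω z => QueryTree.sampleTree (samples ω) z) ω z).run L = val G ω + z := by
    intro G L ω z
    simp only [QueryTree.run_sampleTree, samples, List.map_map, val]
    congr 1
    exact Finset.sum_map_toList _ _
  have hbound : ∀ (G : SimpleGraph (Fin n)) (i : SampleIndex J m) (v : Fin n),
      0 ≤ sampleValue m G i.1 v ∧ sampleValue m G i.1 v ≤ 2 * n / (m * 2 ^ J) :=
    fun G i v => ⟨sampleValue_nonneg G i.1 v, sampleValue_le hm G i.1 v⟩
  refine ⟨noisyAlg hb hrun, noisyAlg_isEdgeDP hb hrun ?_, ?_, ?_⟩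
  · intro G₁ G₂ hG y
    refine (sum_pi_shift_le (h := fun x => Real.exp (-|y - x| / b)) hb
      (fun x => (Real.exp_pos _).le) (exp_neg_abs_div_le hb y)
      (fun i : SampleIndex J m => sampleValue m G₁ i.1)
      (fun i : SampleIndex J m => sampleValue m G₂ i.1) (hbound G₁) (hbound G₂)).trans ?_
    refine mul_le_mul_of_nonneg_right (Real.exp_le_exp.2 ?_)
      (Finset.sum_nonneg fun _ _ => (Real.exp_pos _).le)
    refine (mul_le_mul_of_nonneg_left (sum_abs_sampleValue_sub_le hm hG)
      (by positivity)).trans (le_trans (le_of_eq ?_) hε)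
    rw [Fintype.card_fin]
    field_simp
  · intro G L r t l E ht hl0 hl hE
    set M := ∑ v, ∑ j : Fin J, bucketInv j (compSize G v) with hM
    have htail := card_tail_le (r := r) (fun i : SampleIndex J m => sampleValue m G i.1)
      (fun i v => (abs_of_nonneg (hbound G i v).1).trans_le (hbound G i v).2) hl0 hl
      (M := M) (by rw [sum_sampleValue hm, Fintype.card_fin])
      (by rw [Fintype.card_fin]; exact sum_sampleValue_sq_le hm G)
    -- The truncation error `n / 2^J` is deterministic, so it just widens the radius.
    refine noisyAlg_accuracy hb hrun L (r := n / 2 ^ J + r) ht hE (le_trans ?_ htail)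
    refine Nat.cast_le.2 (Finset.card_le_card fun ω hω => ?_)
    simp only [Finset.mem_filter, Finset.mem_univ, true_and, val] at hω ⊢
    have h1 := abs_sum_bucketInv_sub_numComponents_le G J
    rw [← hM] at h1
    have h2 := abs_sub_le (∑ i : SampleIndex J m, sampleValue m G i.1 (ω i)) M
      (numComponents G : ℝ)
    linarith
  · intro G L ω
    refine (QueryTree.queries_sampleTree L _ _).trans (le_of_eq ?_)
    simp only [samples, List.map_map]
    refine (Finset.sum_map_toList _ _).trans ?_
    simp only [Function.comp_apply]
    rw [Fintype.sum_sigma]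
    have hj : ∀ j : Fin J,
        ∑ _i : Fin (levelSamples J m j), 4 ^ ((j : ℕ) + 1) = m * 4 ^ J := by
      intro j
      rw [Finset.sum_const, Finset.card_univ, Fintype.card_fin, smul_eq_mul, levelSamples,
        mul_assoc, ← pow_add]
      congr 2
      omega
    rw [Finset.sum_congr rfl fun j _ => hj j]
    simp

end SampledAlg

/-! ### Choice of parameters -/

section Parameters

/-- The linear term is `-2 * p * ℓ`. Since `m * D^2 ≥ 256 * p * ℓ * x^2`, the quadratic term returns
at most half of it. -/
theorem bernstein_exponent_le {n p x ℓ m D : ℝ} (hn : 0 < n) (hp : 0 < p) (hx : 0 < x)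
    (hℓ : 0 < ℓ) (hm : 0 < m) (hD : 4 * x ≤ D) (hpm : 16 * p * ℓ ≤ m) :
    -(8 * p * x * ℓ / n * (n / (4 * x))) +
      (8 * p * x * ℓ / n) ^ 2 * (4 * n ^ 2 / (m * D ^ 2)) ≤ -(p * ℓ) := by
  have hD0 : 0 < D := by linarith
  have e3 : 8 * p * x * ℓ / n * (n / (4 * x)) = 2 * (p * ℓ) := by field_simp; norm_num
  have e4 : (8 * p * x * ℓ / n) ^ 2 * (4 * n ^ 2 / (m * D ^ 2)) =
      256 * (p * x * ℓ) ^ 2 / (m * D ^ 2) := by field_simp; norm_num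
  have e5 : 256 * (p * x * ℓ) ^ 2 / (m * D ^ 2) ≤ p * ℓ := by
    rw [div_le_iff₀ (by positivity)]
    have hD2 : (4 * x) ^ 2 ≤ D ^ 2 := pow_le_pow_left₀ (by positivity) hD 2
    have h1 := mul_le_mul hpm hD2 (by positivity) hm.le
    have h2 := mul_le_mul_of_nonneg_left h1 (mul_pos hp hℓ).le
    linarith
  rw [e3, e4]
  linarith

/-- From `8 * x ≤ x^4` follows `J ≤ 6 * log x`; the constant is `6 * 8^2 = 384`, rounded up. -/
theorem sampling_cost_le {s ℓ x m : ℝ} {J : ℕ} (hs : 0 < s) (hℓ : 0.69 ≤ ℓ) (hx : 2 ≤ x)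
    (hm0 : 0 ≤ m) (hm : m ≤ s * ℓ + 1) (hJ : (2 : ℝ) ^ J ≤ 8 * x) :
    J * (m * (2 ^ J) ^ 2) ≤ 400 * (s + 2) * (ℓ * x ^ 2 * Real.log x) := by
  have hlog2 : 0.69 < Real.log 2 := by linarith [Real.log_two_gt_d9]
  have hlogx : Real.log 2 ≤ Real.log x := Real.log_le_log (by norm_num) hx
  have hJ' : (J : ℝ) ≤ 6 * Real.log x := by
    have h1 : (2 : ℝ) ^ J ≤ x ^ 4 := by
      refine hJ.trans ?_
      have h3 := pow_le_pow_left₀ (by norm_num) hx 3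
      nlinarith
    have h2 := Real.log_le_log (by positivity) h1
    rw [Real.log_pow, Real.log_pow] at h2
    have h3 : (J : ℝ) * 0.69 ≤ J * Real.log 2 := by gcongr
    push_cast at h2
    linarith
  have hm' : m ≤ (s + 2) * ℓ := by linarith
  have hJ2 : ((2 : ℝ) ^ J) ^ 2 ≤ (8 * x) ^ 2 := pow_le_pow_left₀ (by positivity) hJ 2
  have h5 : m * (2 ^ J) ^ 2 ≤ (s + 2) * ℓ * (8 * x) ^ 2 :=
    mul_le_mul hm' hJ2 (by positivity) (by positivity)
  have h6 := mul_le_mul hJ' h5 (by positivity) (by linarith)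
  have h7 : 0 ≤ (s + 2) * (ℓ * x ^ 2 * Real.log x) := by
    have : 0 ≤ Real.log x := by linarith
    positivity
  linarith

/-- The sampled estimate has the required accuracy and cost in terms of `x = log n / κ`. -/
theorem exists_alg_of_le {n : ℕ} {c p x ε : ℝ} (hn : 2 ≤ n) (hc : 0 < c) (hp : 0 < p)
    (hε : 0 < ε) (hx : 2 ≤ x) :
    ∃ A : RandQueryAlg n, A.IsEdgeDP ε ∧
      (∀ (G : SimpleGraph (Fin n)) (L : AdjList G) (E : ℝ),
        n / x + 8 * c * Real.log n / ε ≤ E →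
        1 - 2 * Real.exp (-(p * Real.log n)) - Real.exp (-(2 * c * Real.log n)) ≤
          (A.law L).real (Set.Icc ((numComponents G : ℝ) - E) ((numComponents G : ℝ) + E))) ∧
      ∀ (G : SimpleGraph (Fin n)) (L : AdjList G) (ω : A.Coins),
        ((A.tree ω).queries L : ℝ) ≤
          400 * (16 * p + 80 * c + 2) * (Real.log n * x ^ 2 * Real.log x) := by
  have hn' : (2 : ℝ) ≤ n := by exact_mod_cast hn
  have hlog2 : 0.69 < Real.log 2 := by linarith [Real.log_two_gt_d9]
  set ℓ := Real.log n with hℓ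
  have hℓ2 : Real.log 2 ≤ ℓ := Real.log_le_log (by norm_num) hn'
  have hℓ0 : 0 < ℓ := by linarith
  have hx0 : 0 < x := by linarith
  -- The part `16 * p` serves the Bernstein bound; `80 * c` makes a single sample at most `b / 10`.
  set s := 16 * p + 80 * c with hs
  have hs0 : 0 < s := by positivity
  obtain ⟨J', hJ₁, hJ₂⟩ := exists_nat_pow_near (x := 4 * x) (y := 2) (by linarith) (by norm_num)
  set D : ℝ := 2 ^ (J' + 1) with hD
  have hD₁ : 4 * x ≤ D := hJ₂.le
  have hD₂ : D ≤ 8 * x := by rw [hD, pow_succ]; linarith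
  have hD0 : 0 < D := by positivity
  obtain ⟨m, hm₁, hm₂⟩ : ∃ m : ℕ, s * ℓ ≤ m ∧ (m : ℝ) ≤ s * ℓ + 1 :=
    ⟨⌈s * ℓ⌉₊, Nat.le_ceil _, (Nat.ceil_lt_add_one (by positivity)).le⟩
  have hm0' : (0 : ℝ) < m := (by positivity : 0 < s * ℓ).trans_le hm₁
  have hm0 : 0 < m := by exact_mod_cast hm0'
  -- The first term gives privacy, as `3 * exp (2 * B / b) ≤ 4`. The second makes `b` large against
  -- `B`, and adds only `n / (8 * x)` to the noise radius `2 * c * ℓ * b`.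
  set b := 4 / ε + n / (16 * c * x * ℓ) with hb
  have hb₁ : 4 / ε ≤ b := le_add_of_nonneg_right (by positivity)
  have hb₂ : n / (16 * c * x * ℓ) ≤ b := le_add_of_nonneg_left (by positivity)
  have hb0 : 0 < b := (by positivity : 0 < 4 / ε).trans_le hb₁
  set B : ℝ := 2 * n / (m * D) with hB
  have hB0 : 0 ≤ B := by positivity
  have hB₁ : B ≤ n / (2 * m * x) := by
    rw [hB, div_le_div_iff₀ (by positivity) (by positivity)]
    nlinarith [mul_le_mul_of_nonneg_left hD₁ (by positivity : (0 : ℝ) ≤ n * m)]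
  have hcm : 80 * c * ℓ ≤ m := by
    refine le_trans ?_ hm₁
    rw [hs]; nlinarith [mul_pos hp hℓ0]
  have hpm : 16 * p * ℓ ≤ m := by
    refine le_trans ?_ hm₁
    rw [hs]; nlinarith [mul_pos hc hℓ0]
  have hBb : B ≤ 1 / 10 * b := by
    refine hB₁.trans (le_trans ?_ (mul_le_mul_of_nonneg_left hb₂ (by norm_num)))
    rw [div_mul_div_comm, div_le_div_iff₀ (by positivity) (by positivity)]
    nlinarith [mul_le_mul_of_nonneg_left hcm (by positivity : (0 : ℝ) ≤ 2 * n * x)]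
  have hexp : Real.exp (2 * B / b) ≤ 4 / 3 := by
    have h1 : 2 * B / b ≤ 1 / 5 := by rw [div_le_iff₀ hb0]; linarith
    have h2 : 4 / 5 ≤ Real.exp (-(1 / 5)) := by linarith [Real.add_one_le_exp (-(1 / 5 : ℝ))]
    have h3 : Real.exp (1 / 5) * Real.exp (-(1 / 5)) = 1 := by rw [← Real.exp_add]; simp
    have h4 := Real.exp_le_exp.2 h1
    nlinarith [Real.exp_pos (1 / 5)]
  have hDP : 3 * Real.exp (2 * B / b) / b ≤ ε := by
    rw [div_le_iff₀ hb0]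
    have : 4 ≤ b * ε := by rwa [div_le_iff₀ hε] at hb₁
    linarith
  obtain ⟨A, hA₁, hA₂, hA₃⟩ := exists_sampledAlg n (J' + 1) m (by omega) hm0 hb0 hDP
  refine ⟨A, hA₁, fun G L E hE => ?_, fun G L ω => ?_⟩
  · have hl0 : 0 ≤ 8 * p * x * ℓ / n := by positivity
    have hlB : 8 * p * x * ℓ / n * B ≤ 1 := by
      refine (mul_le_mul_of_nonneg_left hB₁ hl0).trans ?_
      rw [div_mul_div_comm, div_le_one (by positivity)]
      have h1 : 0 ≤ n * x * m := by positivity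
      linarith [mul_le_mul_of_nonneg_left hpm (by positivity : (0 : ℝ) ≤ n * x)]
    -- Truncation, sampling and the second part of `b` cost at most `1/4 + 1/4 + 1/8` of `n / x`.
    have htE : n / D + n / (4 * x) + 2 * c * ℓ * b ≤ E := by
      refine le_trans ?_ hE
      have h1 : n / D ≤ n / (4 * x) := div_le_div_of_nonneg_left (by positivity) (by positivity) hD₁
      have h2 : 2 * c * ℓ * b = 8 * c * ℓ / ε + n / x / 8 := by
        rw [hb]; field_simp; ring
      have h3 : (n : ℝ) / (4 * x) = n / x / 4 := by field_simp
      have h4 : 0 ≤ (n : ℝ) / x := by positivity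
      linarith
    have hacc := hA₂ G L (n / (4 * x)) (2 * c * ℓ * b) (8 * p * x * ℓ / n) E
      (by positivity) hl0 hlB htE
    refine le_trans ?_ hacc
    have e1 : -(2 * c * ℓ * b) / b = -(2 * c * ℓ) := by field_simp
    have e2 := bernstein_exponent_le (n := n) (by linarith) hp hx0 hℓ0 hm0' hD₁ hpm
    rw [e1]
    linarith [Real.exp_le_exp.2 e2]
  · have hq : ((A.tree ω).queries L : ℝ) ≤ (J' + 1 : ℕ) * (m * D ^ 2) := by
      have h4 : (4 : ℝ) ^ (J' + 1) = D ^ 2 := by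
        rw [hD, ← pow_mul, mul_comm, pow_mul]; norm_num
      rw [← h4]
      exact_mod_cast hA₃ G L ω
    refine hq.trans ?_
    exact sampling_cost_le hs0 (by linarith) hx hm0'.le hm₂ hD₂

/-- After division by `exp (-(c * l))` the term `exp (-(c * l))` remains, at most `2^(-c) = 1 - q`
for `l ≥ log 2`. Taking `p = c + k` with `k` large fits the other term into the gap `q`. -/
theorem exists_exponent {c : ℝ} (hc : 0 < c) :
    ∃ p : ℝ, 0 < p ∧ ∀ l : ℝ, Real.log 2 ≤ l →
      2 * Real.exp (-(p * l)) + Real.exp (-(2 * c * l)) ≤ Real.exp (-(c * l)) := by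
  have hlog2 : 0 < Real.log 2 := Real.log_pos (by norm_num)
  set q := 1 - Real.exp (-(c * Real.log 2)) with hq
  have hq0 : 0 < q := by
    rw [hq, sub_pos, Real.exp_lt_one_iff]
    nlinarith [mul_pos hc hlog2]
  have hq1 : q < 1 := by
    rw [hq]; linarith [Real.exp_pos (-(c * Real.log 2))]
  set k := -Real.log (q / 2) / Real.log 2 with hk
  have hk0 : 0 < k := by
    refine div_pos ?_ hlog2
    rw [neg_pos]
    exact Real.log_neg (by linarith) (by linarith)
  refine ⟨c + k, by linarith, fun l hl => ?_⟩
  have h1 : Real.exp (-(k * l)) ≤ q / 2 := by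
    rw [← Real.exp_log (by linarith : 0 < q / 2), Real.exp_le_exp]
    have : k * Real.log 2 = -Real.log (q / 2) := by rw [hk]; field_simp
    nlinarith
  have h2 : Real.exp (-(c * l)) ≤ 1 - q := by
    rw [hq, sub_sub_cancel, Real.exp_le_exp]
    nlinarith
  have e1 : Real.exp (-((c + k) * l)) = Real.exp (-(c * l)) * Real.exp (-(k * l)) := by
    rw [← Real.exp_add]; congr 1; ring
  have e2 : Real.exp (-(2 * c * l)) = Real.exp (-(c * l)) * Real.exp (-(c * l)) := by
    rw [← Real.exp_add]; congr 1; ring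
  rw [e1, e2]
  nlinarith [Real.exp_pos (-(c * l))]

end Parameters

/-! ### The main theorem: three regimes of `log n / κ` -/

theorem mainTheorem6 (c : ℝ) (hc : 0 < c) :
    ∃ C : ℝ, 0 < C ∧
      ∀ (K : ℕ) (ε κ : ℝ), 0 < K → 0 < ε → 0 < κ →
        ∃ A : (n : ℕ) → RandQueryAlg n,
          -- privacy
          (∀ n : ℕ, (A n).IsEdgeDP ε) ∧
          -- accuracy
          (∀ n : ℕ, 2 ≤ n → ∀ (G : SimpleGraph (Fin n)) (L : AdjList G),
            1 - 1 / (n : ℝ) ^ c - 1 / ((n : ℝ) ^ (c - 1) * (Real.exp ε - 1) / K + 1) ≤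
              ((A n).law L).real
                (Set.Icc ((numComponents G : ℝ) - ccError K c ε κ n)
                  ((numComponents G : ℝ) + ccError K c ε κ n))) ∧
          -- number of queries, for every outcome of the coins
          (∀ n : ℕ, 2 ≤ n → ∀ (G : SimpleGraph (Fin n)) (L : AdjList G) (ω : (A n).Coins),
            (((A n).tree ω).queries L : ℝ) ≤
              C * (Real.log n ^ 3 / κ ^ 2 * max 0 (Real.log (Real.log n / κ)))) := by
  obtain ⟨p, hp, hexp⟩ := exists_exponent hc
  refine ⟨400 * (16 * p + 80 * c + 2), by positivity, fun K ε κ hK hε hκ => ?_⟩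
  have hall : ∀ n : ℕ, ∃ A : RandQueryAlg n, A.IsEdgeDP ε ∧ (2 ≤ n →
      (∀ (G : SimpleGraph (Fin n)) (L : AdjList G),
        1 - Real.exp (-(c * Real.log n)) ≤ (A.law L).real
          (Set.Icc ((numComponents G : ℝ) - ccError K c ε κ n)
            ((numComponents G : ℝ) + ccError K c ε κ n))) ∧
      ∀ (G : SimpleGraph (Fin n)) (L : AdjList G) (ω : A.Coins),
        ((A.tree ω).queries L : ℝ) ≤ 400 * (16 * p + 80 * c + 2) *
          (Real.log n ^ 3 / κ ^ 2 * max 0 (Real.log (Real.log n / κ)))) := by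
    intro n
    by_cases hn : 2 ≤ n
    swap
    · obtain ⟨A, hA, -⟩ := exists_constAlg n 0 hε
      exact ⟨A, hA, fun h => absurd h hn⟩
    have hn' : (2 : ℝ) ≤ n := by exact_mod_cast hn
    have hlog2 : 0.69 < Real.log 2 := by linarith [Real.log_two_gt_d9]
    have hℓ2 : Real.log 2 ≤ Real.log n := Real.log_le_log (by norm_num) hn'
    have hK' : (0 : ℝ) < K := by exact_mod_cast hK
    have herr : ccError K c ε κ n = n / (Real.log n / κ) + 8 * c * (κ * n) / ε +
        2 * c * Real.log n / ε + 1 / ((K : ℝ) * n) := by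
      rw [ccError, div_div_eq_mul_div]; ring
    have hcost : Real.log n ^ 3 / κ ^ 2 = Real.log n * (Real.log n / κ) ^ 2 := by
      rw [div_pow]; ring
    set ℓ := Real.log n with hℓ
    have hℓ0 : 0 < ℓ := by linarith
    have hx0 : 0 < ℓ / κ := by positivity
    set x := ℓ / κ with hx
    have hKn : 0 ≤ 1 / ((K : ℝ) * n) := by positivity
    have hnx : 0 ≤ n / x := by positivity
    have h8 : 0 ≤ 8 * c * (κ * n) / ε := by positivity
    have h2c : 0 ≤ 2 * c * ℓ / ε := by positivity
    rw [hcost, herr]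
    -- Every count in `[0, n]` is within `n / 2 < n / x` of `n / 2`, so no query is needed.
    rcases lt_or_ge x 2 with hx2 | hx2
    · obtain ⟨A, hA₁, hA₂, hA₃⟩ := exists_constAlg n (n / 2) hε
      refine ⟨A, hA₁, fun _ => ⟨fun G L => ?_, fun G L ω => ?_⟩⟩
      · have h1 : (n : ℝ) / 2 ≤ n / x := div_le_div_of_nonneg_left (by positivity) hx0 hx2.le
        have h2 := numComponents_le_card G
        rw [Fintype.card_fin] at h2
        have h3 : (0 : ℝ) ≤ numComponents G := by positivity
        rw [hA₂ G L _ _ (by linarith) (by linarith)]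
        linarith [Real.exp_pos (-(c * ℓ))]
      · rw [hA₃ G L ω, Nat.cast_zero]
        positivity
    have hlogx : Real.log 2 ≤ Real.log x := Real.log_le_log (by norm_num) hx2
    rw [max_eq_right (by linarith : 0 ≤ Real.log x)]
    -- The case `x ≤ n` means `log n ≤ κ * n`, so the noise term `8 * c * log n / ε` fits into `8 *
    -- c * κ * n / ε`. Otherwise `n^2 < x^2` pays for reading the graph, and the noise radius is `2
    -- * c * log n / ε`.
    rcases le_or_gt x n with hxn | hxn
    · obtain ⟨A, hA₁, hA₂, hA₃⟩ := exists_alg_of_le hn hc hp hε hx2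
      refine ⟨A, hA₁, fun _ => ⟨fun G L => ?_, hA₃⟩⟩
      refine le_trans ?_ (hA₂ G L _ ?_)
      · linarith [hexp ℓ hℓ2]
      · have h1 : ℓ ≤ κ * n := by
          rw [hx, div_le_iff₀ hκ] at hxn
          linarith
        have h2 : 8 * c * ℓ / ε ≤ 8 * c * (κ * n) / ε := by gcongr
        linarith
    · obtain ⟨A, hA₁, hA₂, hA₃⟩ := exists_exactAlg n hε
      refine ⟨A, hA₁, fun _ => ⟨fun G L => ?_, fun G L ω => ?_⟩⟩
      · refine le_trans ?_ (hA₂ G L (2 * c * ℓ / ε) _ h2c (by linarith))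
        have e1 : -(2 * c * ℓ / ε) / (1 / ε) = -(2 * c * ℓ) := by field_simp
        rw [e1]
        linarith [hexp ℓ hℓ2, Real.exp_pos (-(p * ℓ))]
      · have h1 : ((A.tree ω).queries L : ℝ) ≤ n * n := by exact_mod_cast hA₃ G L ω
        have h2 : (n : ℝ) * n ≤ x ^ 2 := by nlinarith
        have h3 : 0.4 ≤ ℓ * Real.log x := by nlinarith
        have h4 : 1 ≤ 400 * (16 * p + 80 * c + 2) * (ℓ * Real.log x) := by nlinarith
        have h5 := mul_le_mul_of_nonneg_right h4 (sq_nonneg x)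
        nlinarith
  choose A hA₁ hA₂ using hall
  refine ⟨A, hA₁, fun n hn G L => le_trans ?_ ((hA₂ n hn).1 G L), fun n hn => (hA₂ n hn).2⟩
  have hn0 : (0 : ℝ) < n := by exact_mod_cast (by omega : 0 < n)
  have h1 : 1 / (n : ℝ) ^ c = Real.exp (-(c * Real.log n)) := by
    rw [Real.rpow_def_of_pos hn0, one_div, ← Real.exp_neg, mul_comm]
  -- The second failure term is nonnegative, so failure probability `n^(-c)` suffices.
  have h2 : 0 ≤ 1 / ((n : ℝ) ^ (c - 1) * (Real.exp ε - 1) / K + 1) := by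
    have : 0 ≤ Real.exp ε - 1 := by linarith [Real.add_one_le_exp ε]
    positivity
  rw [h1]
  linarith
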